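/- Let $0<f<1$ and $\kappa\in\mathbb R$ satisfy $\sqrt2\,\mathrm{erfinv}(1-2f)+\kappa\ge 0$, where $\mathrm{erfinv}$ is the inverse of $\mathrm{erf}(y)=\frac{2}{\sqrt\pi}\int_0^y e^{-t^2}dt$; equivalently, $f\le\frac1{\sqrt{2\pi}}\int_{-\infty}^{\kappa}e^{-z^2/2}dz$. Let $\alpha>0$, and let $m=m_n$ and $k=k_n$ be natural numbers with $m_n/n\to\alpha$ and $k_n/m_n\to 1-f$ as $n\to\infty$ (the case $m=\alpha n$, $k=(1-f)m$, up to rounding). Let $H$ be an $m\times n$ matrix with i.i.d. standard normal entries. Put $$\hat\nu=\bigl(\sqrt2\,\mathrm{erfinv}(1-2f)+\kappa\bigr)^2,\qquad \hat f_{err}(\kappa)=\frac1{\sqrt{2\pi}}\int_{-\kappa}^{\sqrt{\hat\nu}-\kappa}(g+\kappa)^2e^{-g^2/2}\,dg,$$ $$\xi_{wb}=\min_{\substack{x\in\mathbb R^n,\ \|x\|_2=1\\ d\in\{0,1\}^m,\ \sum_i d_i=k}}\ \max_{\substack{\lambda\in\mathbb R^m,\ \|\lambda\|_2=1\\ \lambda_i\ge0}}\bigl(\kappa\,\lambda^T\mathrm{diag}(d)\mathbf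 1-\lambda^T\mathrm{diag}(d)Hx\bigr).$$ Say that an event holds with overwhelming probability if, for some $c>0$ and all large $n$, its probability is at least $1-e^{-cn}$. Call the perceptron feasible if there are $x\in\mathbb R^n$ with $\|x\|_2=1$ and $d\in\{0,1\}^m$ with $\sum_i d_i=k$ such that $d_i\bigl((Hx)_i-\kappa\bigr)\ge0$ for all $i\le m$, that is, if some unit vector $x$ satisfies $(Hx)_i\ge\kappa$ for at least $k$ rows $i$. Below, $1/0=\infty$. Then: 1. For all $\varepsilon_1,\varepsilon_2,\varepsilon_3>0$ and all real $\xi^{(l)}=\xi^{(l)}_n$ such that, for all large $n$, $$\frac{\xi^{(l)}}{\sqrt n}<(1-\varepsilon_1)\sqrt{\alpha\hat f_{err}(\kappa)}-(1+\varepsilon_2)-\varepsilon_3,$$ one has $\lim_{n\to\infty}P(\xi_{wb}\ge\xi^{(l)})=1$. 2. If $\alpha>1/\hat f_{err}(\kappa)$, then with overwhelming probability the perceptron is not feasible. 3. The Gardner–Derrida replica prediction is a rigorous upper bound on the storage capacity. Precisely, the equation $f=\frac1{\sqrt{2\pi}}\int_{-\infty}^{\kappa-x}e^{-z^2/2}dz$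 has exactly one real solution $x$; it is $x=\sqrt{\hat\nu}$; the prediction $\bigl(\frac1{\sqrt{2\pi}}\int_{\kappa-x}^{\kappa}(z-\kappa)^2e^{-z^2/2}dz\bigr)^{-1}$ equals $1/\hat f_{err}(\kappa)$; and it is at least the storage capacity, that is, the supremum (taken to be $0$ if there are none) of all ratios $\alpha'>0$ for which the perceptron with $m=\lfloor\alpha' n\rfloor$ and $k=\lceil(1-f)m\rceil$ is feasible with overwhelming probability. -/

import Mathlib

open Filter Topology MeasureTheory ProbabilityTheory
open scoped ENNReal

namespace SphericalPerceptron

/-- The error function `erf y = (2/√π) ∫₀^y e^{-t²} dt`. -/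
noncomputable def erf (y : ℝ) : ℝ :=
  2 / √Real.pi * ∫ t in (0 : ℝ)..y, Real.exp (-t ^ 2)

/-- The inverse error function: for `-1 < s < 1`, the unique real `y` with `erf y = s`
(`erf` is an increasing bijection of `ℝ` onto `(-1, 1)`); only such `s` are used. -/
noncomputable def erfinv : ℝ → ℝ := Function.invFun erf

/-- `ν̂ = (√2 erfinv(1 - 2f) + κ)²`. -/
noncomputable def nuHat (κ f : ℝ) : ℝ :=
  (√2 * erfinv (1 - 2 * f) + κ) ^ 2

/-- `f̂_err(κ) = (1/√(2π)) ∫_{-κ}^{√ν̂ - κ} (g + κ)² e^{-g²/2} dg`. -/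
noncomputable def fErrHat (κ f : ℝ) : ℝ :=
  1 / √(2 * Real.pi) *
    ∫ g in (-κ)..(√(nuHat κ f) - κ), (g + κ) ^ 2 * Real.exp (-g ^ 2 / 2)

/-- The law of an `m × n` array of i.i.d. standard normal random variables. -/
noncomputable def gaussianMatrix (m n : ℕ) : Measure (Fin m → Fin n → ℝ) :=
  Measure.pi fun _ => Measure.pi fun _ => gaussianReal 0 1

/-- The 0/1 vectors in `ℝᵐ` with exactly `k` entries equal to `1`. -/
def selectionVectors (m k : ℕ) : Set (Fin m → ℝ) :=
  {d | (∀ i, d i = 0 ∨ d i = 1) ∧ ∑ i, d i = k}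

/-- The Euclidean unit vectors of `ℝᵐ` with nonnegative entries. -/
def nonnegUnitVectors (m : ℕ) : Set (EuclideanSpace ℝ (Fin m)) :=
  {l | ‖l‖ = 1 ∧ ∀ i, 0 ≤ l i}

/-- The objective `κ λᵀ diag(d) 1 - λᵀ diag(d) H x`. -/
noncomputable def objective {m n : ℕ} (κ : ℝ) (H : Matrix (Fin m) (Fin n) ℝ)
    (x : EuclideanSpace ℝ (Fin n)) (d : Fin m → ℝ) (l : EuclideanSpace ℝ (Fin m)) : ℝ :=
  κ * (l.ofLp ⬝ᵥ (Matrix.diagonal d).mulVec 1) -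
    l.ofLp ⬝ᵥ (Matrix.diagonal d).mulVec (H.mulVec x.ofLp)

/-- `ξ_wb`: the minimum over unit vectors `x` and over selections `d` of `k` rows of the maximum
over nonnegative unit vectors `λ` of the objective. For `1 ≤ m`, `1 ≤ n` and `k ≤ m` all the index
sets are nonempty and compact, so the infimum and the supremum are a minimum and a maximum. -/
noncomputable def xiWb {m n : ℕ} (κ : ℝ) (k : ℕ) (H : Matrix (Fin m) (Fin n) ℝ) : ℝ :=
  ⨅ p : Metric.sphere (0 : EuclideanSpace ℝ (Fin n)) 1 × selectionVectors m k,
    ⨆ l : nonnegUnitVectors m, objective κ H p.1 p.2 l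

/-- The feasibility problem of the spherical perceptron with errors: some unit vector `x` satisfies
`(H x)_i ≥ κ` for all the rows `i` picked by some selection `d` of `k` rows, that is, for at least
`k` rows. -/
def Feasible {m n : ℕ} (κ : ℝ) (k : ℕ) (H : Matrix (Fin m) (Fin n) ℝ) : Prop :=
  ∃ x : EuclideanSpace ℝ (Fin n), ‖x‖ = 1 ∧ ∃ d ∈ selectionVectors m k,
    ∀ i, 0 ≤ d i * (H.mulVec x.ofLp i - κ)

/-- The property `E n` of `m n × n` matrices with i.i.d. standard normal entries holds with
overwhelming probability: the probability is at least `1 - e^{-c n}` for some constant `c > 0` and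
all large `n`. -/
def WithOverwhelmingProbability (m : ℕ → ℕ)
    (E : ∀ n, Matrix (Fin (m n)) (Fin n) ℝ → Prop) : Prop :=
  ∃ c : ℝ, 0 < c ∧ ∀ᶠ n : ℕ in atTop,
    1 - Real.exp (-c * n) ≤ (gaussianMatrix (m n) n).real {H | E n (Matrix.of H)}

/-- The storage capacity with a fraction `f` of errors allowed: the supremum of the ratios `α > 0`
such that, with `m = ⌊α n⌋` patterns of which `⌈(1 - f) m⌉` have to be stored correctly, the
perceptron is feasible with overwhelming probability. -/
noncomputable def storageCapacity (κ f : ℝ) : ℝ≥0∞ :=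
  ⨆ (α : ℝ) (_ : 0 < α ∧ WithOverwhelmingProbability (fun n => ⌊α * n⌋₊)
    fun n H => Feasible κ ⌈(1 - f) * (⌊α * n⌋₊ : ℝ)⌉₊ H), ENNReal.ofReal α

/-- The first replica equation: `f = (1/√(2π)) ∫_{-∞}^{κ - x} e^{-z²/2} dz`. -/
def GardnerDerridaEquation (κ f x : ℝ) : Prop :=
  f = 1 / √(2 * Real.pi) * ∫ z in Set.Iic (κ - x), Real.exp (-z ^ 2 / 2)

/-- The replica prediction
`((1/√(2π)) ∫_{κ - x}^κ (z - κ)² e^{-z²/2} dz)⁻¹`, for `x ≥ 0`, with the convention `1/0 = ∞`. -/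
noncomputable def gardnerDerridaCapacity (κ x : ℝ) : ℝ≥0∞ :=
  (ENNReal.ofReal (1 / √(2 * Real.pi) *
    ∫ z in (κ - x)..κ, (z - κ) ^ 2 * Real.exp (-z ^ 2 / 2)))⁻¹

end SphericalPerceptron

open SphericalPerceptron

/-!
Let `K` be the set of the vectors of `ℝᵐ` that satisfy at least `k` of the constraints `κ ≤ y_i`.
For `k < m` the min-max `ξ_wb` is at least the least distance of the points `H x`, `‖x‖ = 1`, to `K`
(`residual_le_iSup_objective`), and feasibility means that some `H x` lies in `K`
(`Feasible.nearlyFeasible`). So everything follows from a lower bound on that least distance.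

The bound is Gordon's comparison of the process `x ↦ (H x, g₀)` with the process `x ↦ (g, ⟨h, x⟩)`,
where `g₀`, `g`, `h` are independent standard Gaussian: since the distance functions are
`1`-Lipschitz, passing from the second process to the first one can only lower the exponential
moments `E exp (-c min_x (dist + scalar))`. The proof (`integral_partitionSum_rpow_le`) interpolates
between the two processes along a quarter of a circle and replaces the minimum by the free energy of
a partition function. At each time the velocity of a coordinate of the process at `x` is independent
of the process at `x`; Stein's lemma in the direction of this velocity
(`integral_dotProduct_mul_stdGaussian`) turns the time derivative into a sum over pairs `x, x'` of
nonnegative Gibbs weights times `(1 - ⟨x, x'⟩) (1 - ⟨∇dist, ∇dist'⟩) ≥ 0`, up to a nonpositive factor.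
Since only first derivatives of the potentials enter, a continuously differentiable smoothing of the
distance is enough.

With `E exp (-c g₀) = exp (c² / 2)` and Markov's inequality the comparison gives
`P (∃ x, dist (H x, K) < t) ≤ exp (c t - c² / 2) · E exp (-c dist (g, K)) · E exp (c ‖h‖)`
(`measureReal_nearlyFeasible_le`). Here `‖h‖ ≈ √n`, and `dist (g, K)² ≥ ∑ min ((κ - g_i)₊², τ) -
(m - k) τ` for every `τ`. For `τ = ν̂`, the level that `(κ - g_i)₊²` exceeds with probability `f`, the
right side has mean about `m f̂_err` (`integral_truncatedViolation_nuHat`) and concentrates by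
Hoeffding's inequality. Taking `c` a small multiple of `√n` makes the probability exponentially small
as soon as `t / √n < √(α f̂_err) - 1` (`exists_eventually_measureReal_nearlyFeasible_le`).

The events need not be measurable for this: their complements are bounded in outer measure.
-/

namespace SphericalPerceptron

/-! ### The standard Gaussian measure on a finite product of lines -/

/-- The standard Gaussian measure on `ι → ℝ`: the law of i.i.d. standard normal variables. -/
noncomputable def stdGaussian (ι : Type*) [Fintype ι] : Measure (ι → ℝ) :=
  Measure.pi fun _ => gaussianReal 0 1

/-- The density of `stdGaussian ι` with respect to Lebesgue measure. -/
noncomputable def stdGaussianDensity {ι : Type*} [Fintype ι] (z : ι → ℝ) : ℝ :=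
  ∏ i, gaussianPDFReal 0 1 (z i)

section Stein

variable {ι : Type*} [Fintype ι]

instance : IsProbabilityMeasure (stdGaussian ι) := by
  unfold stdGaussian; infer_instance

lemma stdGaussianDensity_pos (z : ι → ℝ) : 0 < stdGaussianDensity z :=
  Finset.prod_pos fun i _ => gaussianPDFReal_pos 0 1 (z i) one_ne_zero

lemma measurable_stdGaussianDensity : Measurable (stdGaussianDensity (ι := ι)) :=
  Finset.measurable_prod _ fun i _ => (measurable_gaussianPDFReal 0 1).comp (measurable_pi_apply i)

lemma stdGaussian_eq_withDensity :
    stdGaussian ι = volume.withDensity fun z => ENNReal.ofReal (stdGaussianDensity z) := by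
  refine Measure.pi_eq fun s hs => ?_
  have hint : Integrable (stdGaussianDensity (ι := ι)) (volume.restrict (Set.univ.pi s)) := by
    refine Integrable.restrict ?_
    exact Integrable.fintype_prod (f := fun _ => gaussianPDFReal 0 1)
      fun _ => integrable_gaussianPDFReal 0 1
  rw [withDensity_apply _ (MeasurableSet.univ_pi hs),
    ← ofReal_integral_eq_lintegral_ofReal hint
      (ae_of_all _ fun z => (stdGaussianDensity_pos z).le), volume_pi, Measure.restrict_pi_pi]
  simp only [stdGaussianDensity]
  rw [integral_fintype_prod_eq_prod (f := fun _ => gaussianPDFReal 0 1),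
    ENNReal.ofReal_prod_of_nonneg]
  · exact Finset.prod_congr rfl fun i _ =>
      (gaussianReal_apply_eq_integral 0 one_ne_zero (s i)).symm
  · exact fun i _ => integral_nonneg fun x => gaussianPDFReal_nonneg 0 1 x

lemma integral_stdGaussian (F : (ι → ℝ) → ℝ) :
    ∫ z, F z ∂stdGaussian ι = ∫ z, stdGaussianDensity z * F z := by
  rw [stdGaussian_eq_withDensity, integral_withDensity_eq_integral_toReal_smul
    measurable_stdGaussianDensity.ennreal_ofReal (ae_of_all _ fun z => ENNReal.ofReal_lt_top)]
  simp [ENNReal.toReal_ofReal (stdGaussianDensity_pos _).le]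

lemma integrable_stdGaussian_iff (F : (ι → ℝ) → ℝ) :
    Integrable F (stdGaussian ι) ↔ Integrable fun z => stdGaussianDensity z * F z := by
  rw [stdGaussian_eq_withDensity, integrable_withDensity_iff_integrable_smul'
    measurable_stdGaussianDensity.ennreal_ofReal (ae_of_all _ fun z => ENNReal.ofReal_lt_top)]
  simp [ENNReal.toReal_ofReal (stdGaussianDensity_pos _).le]

lemma stdGaussianDensity_eq_exp (z : ι → ℝ) :
    stdGaussianDensity z = (√(2 * Real.pi))⁻¹ ^ Fintype.card ι * Real.exp (-(∑ i, z i ^ 2) / 2) := by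
  simp only [stdGaussianDensity, gaussianPDFReal, NNReal.coe_one, mul_one, sub_zero,
    Finset.prod_mul_distrib, Finset.prod_const, Finset.card_univ, ← Real.exp_sum,
    ← Finset.sum_div, Finset.sum_neg_distrib]

lemma hasLineDerivAt_stdGaussianDensity (z u : ι → ℝ) :
    HasLineDerivAt ℝ stdGaussianDensity (-(u ⬝ᵥ z) * stdGaussianDensity z) z u := by
  unfold HasLineDerivAt
  have h : HasDerivAt (fun t : ℝ => -(∑ i, (z i + t * u i) ^ 2) / 2) (-(u ⬝ᵥ z)) 0 := by
    have h1 : HasDerivAt (fun t : ℝ => ∑ i, (z i + t * u i) ^ 2) (∑ i, 2 * (u i * z i)) 0 := by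
      refine HasDerivAt.fun_sum fun i _ => ?_
      refine (((((hasDerivAt_id (0 : ℝ)).mul_const (u i)).const_add (z i)).pow 2)).congr_deriv ?_
      simp; ring
    refine (h1.neg.div_const 2).congr_deriv ?_
    rw [← Finset.mul_sum, dotProduct]; ring
  have hfun : (fun t : ℝ => stdGaussianDensity (z + t • u)) = fun t : ℝ =>
      (√(2 * Real.pi))⁻¹ ^ Fintype.card ι * Real.exp (-(∑ i, (z i + t * u i) ^ 2) / 2) := by
    funext t; rw [stdGaussianDensity_eq_exp]; simp
  rw [hfun]
  refine (h.exp.const_mul ((√(2 * Real.pi))⁻¹ ^ Fintype.card ι)).congr_deriv ?_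
  rw [stdGaussianDensity_eq_exp]; simp; ring

/-- **Stein's lemma** along a direction `u`. Only differentiability along `u` is required. -/
lemma integral_dotProduct_mul_stdGaussian {F F' : (ι → ℝ) → ℝ} {u : ι → ℝ}
    (hF : ∀ z, HasLineDerivAt ℝ F (F' z) z u) (hi : Integrable F (stdGaussian ι))
    (hi' : Integrable F' (stdGaussian ι))
    (hiu : Integrable (fun z => (u ⬝ᵥ z) * F z) (stdGaussian ι)) :
    ∫ z, (u ⬝ᵥ z) * F z ∂stdGaussian ι = ∫ z, F' z ∂stdGaussian ι := by
  rw [integrable_stdGaussian_iff] at hi hi' hiu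
  have h := integral_bilinear_hasLineDerivAt_right_eq_neg_left_of_integrable
    (μ := (volume : Measure (ι → ℝ))) (f := stdGaussianDensity)
    (f' := fun z => -(u ⬝ᵥ z) * stdGaussianDensity z)
    (g := F) (g' := F') (v := u) (B := ContinuousLinearMap.mul ℝ ℝ)
    (by convert hiu.neg using 2; simp; ring) (by simpa using hi') (by simpa using hi)
    (fun z _ => hasLineDerivAt_stdGaussianDensity z u) (fun z _ => hF z)
  simp only [ContinuousLinearMap.mul_apply'] at h
  rw [integral_stdGaussian, integral_stdGaussian, h, ← integral_neg]
  congr 1; funext z; ring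

lemma integrable_exp_sum_abs_stdGaussian (C : ℝ) :
    Integrable (fun z : ι → ℝ => Real.exp (C * ∑ i, |z i|)) (stdGaussian ι) := by
  have h : Integrable (fun x : ℝ => Real.exp (C * |x|)) (gaussianReal 0 1) :=
    integrable_exp_mul_abs (integrable_exp_mul_gaussianReal C)
      (integrable_exp_mul_gaussianReal (-C))
  simp_rw [Finset.mul_sum, Real.exp_sum]
  exact Integrable.fintype_prod (f := fun _ x => Real.exp (C * |x|)) fun _ => h

end Stein

/-! ### Gaussian interpolation -/

section Comparison

variable {ι J P : Type*}

/-- The point at angle `θ` of the path from the family `B` to the family `A` of vectors. -/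
noncomputable def arc (A B : P → J → ι → ℝ) (θ : ℝ) (p : P) (j : J) : ι → ℝ :=
  Real.cos θ • B p j + Real.sin θ • A p j

/-- The velocity of `arc`. -/
noncomputable def arcVelocity (A B : P → J → ι → ℝ) (θ : ℝ) (p : P) (j : J) : ι → ℝ :=
  -Real.sin θ • B p j + Real.cos θ • A p j

/-- The partition function `∑_p e^{-β Φ_p(y_p)}`, whose logarithm is a smooth version of the minimum
of the `Φ_p(y_p)`. -/
noncomputable def partitionSum [Fintype P] (β : ℝ) (Φ : P → (J → ℝ) → ℝ) (y : P → J → ℝ) : ℝ :=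
  ∑ p, Real.exp (-β * Φ p (y p))

/-- The values at `z` of the linear functionals given by a family of vectors. -/
def evalAt [Fintype ι] (L : P → J → ι → ℝ) (z : ι → ℝ) (p : P) (j : J) : ℝ := L p j ⬝ᵥ z

lemma abs_dotProduct_le_mul_sum [Fintype ι] {M : ℝ} {u : ι → ℝ} (hu : ∀ i, |u i| ≤ M) (z : ι → ℝ) :
    |u ⬝ᵥ z| ≤ M * ∑ i, |z i| := by
  rw [dotProduct, Finset.mul_sum]
  refine (Finset.abs_sum_le_sum_abs _ _).trans (Finset.sum_le_sum fun i _ => ?_)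
  rw [abs_mul]
  exact mul_le_mul_of_nonneg_right (hu i) (abs_nonneg _)

lemma arcVelocity_dotProduct_arc [Fintype ι] {A B : P → J → ι → ℝ} (hAB : ∀ p q j k, A p j ⬝ᵥ B q k = 0)
    (θ : ℝ) (p q : P) (j k : J) :
    arcVelocity A B θ p j ⬝ᵥ arc A B θ q k =
      Real.sin θ * Real.cos θ * (A p j ⬝ᵥ A q k - B p j ⬝ᵥ B q k) := by
  have h : B p j ⬝ᵥ A q k = 0 := by rw [dotProduct_comm]; exact hAB q p k j
  simp only [arc, arcVelocity, add_dotProduct, dotProduct_add, smul_dotProduct, dotProduct_smul,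
    smul_eq_mul, hAB, h]
  ring

variable {A B : P → J → ι → ℝ} {Φ : P → (J → ℝ) → ℝ} {D : P → (J → ℝ) → J → ℝ} {β r K M : ℝ}

lemma abs_arc_le (hM : ∀ p j i, |A p j i| + |B p j i| ≤ M) (θ : ℝ) (p : P) (j : J) (i : ι) :
    |arc A B θ p j i| ≤ M := by
  refine le_trans ?_ (hM p j i)
  have h1 : |Real.cos θ * B p j i| ≤ |B p j i| := by
    rw [abs_mul]; exact mul_le_of_le_one_left (abs_nonneg _) (Real.abs_cos_le_one θ)
  have h2 : |Real.sin θ * A p j i| ≤ |A p j i| := by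
    rw [abs_mul]; exact mul_le_of_le_one_left (abs_nonneg _) (Real.abs_sin_le_one θ)
  have h3 := abs_add_le (Real.cos θ * B p j i) (Real.sin θ * A p j i)
  simp only [arc, Pi.add_apply, Pi.smul_apply, smul_eq_mul]
  linarith

lemma abs_arcVelocity_le (hM : ∀ p j i, |A p j i| + |B p j i| ≤ M) (θ : ℝ) (p : P) (j : J)
    (i : ι) : |arcVelocity A B θ p j i| ≤ M := by
  refine le_trans ?_ (hM p j i)
  have h1 : |-Real.sin θ * B p j i| ≤ |B p j i| := by
    rw [abs_mul, abs_neg]; exact mul_le_of_le_one_left (abs_nonneg _) (Real.abs_sin_le_one θ)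
  have h2 : |Real.cos θ * A p j i| ≤ |A p j i| := by
    rw [abs_mul]; exact mul_le_of_le_one_left (abs_nonneg _) (Real.abs_cos_le_one θ)
  have h3 := abs_add_le (-Real.sin θ * B p j i) (Real.cos θ * A p j i)
  simp only [arcVelocity, Pi.add_apply, Pi.smul_apply, smul_eq_mul]
  linarith

lemma partitionSum_pos [Fintype P] [Nonempty P] (y : P → J → ℝ) : 0 < partitionSum β Φ y :=
  Finset.sum_pos (fun _ _ => Real.exp_pos _) Finset.univ_nonempty

lemma exp_le_partitionSum [Fintype P] (y : P → J → ℝ) (p : P) :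
    Real.exp (-β * Φ p (y p)) ≤ partitionSum β Φ y :=
  Finset.single_le_sum (f := fun p => Real.exp (-β * Φ p (y p)))
    (fun _ _ => (Real.exp_pos _).le) (Finset.mem_univ p)

/-- Along a differentiable curve the derivative of the partition function is given by the
gradients `D` of the potentials. -/
lemma hasDerivAt_partitionSum [Fintype J] [Fintype P]
    (hΦ : ∀ p y, HasFDerivAt (Φ p) (∑ j, D p y j • ContinuousLinearMap.proj (R := ℝ) j) y)
    {y : ℝ → P → J → ℝ} {y' : P → J → ℝ} {t : ℝ}
    (hy : ∀ p j, HasDerivAt (fun s => y s p j) (y' p j) t) :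
    HasDerivAt (fun s => partitionSum β Φ (y s))
      (-β * ∑ p, Real.exp (-β * Φ p (y t p)) * ∑ j, D p (y t p) j * y' p j) t := by
  rw [Finset.mul_sum]
  refine HasDerivAt.fun_sum fun p _ => ?_
  have h1 : HasDerivAt (fun s => y s p) (y' p) t := hasDerivAt_pi.2 fun j => hy p j
  have h2 : HasDerivAt (fun s => Φ p (y s p)) (∑ j, D p (y t p) j * y' p j) t := by
    refine ((hΦ p (y t p)).comp_hasDerivAt t h1).congr_deriv ?_
    simp
  refine (h2.const_mul (-β)).exp.congr_deriv ?_
  ring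

lemma continuous_evalAt [Fintype ι] (L : P → J → ι → ℝ) (p : P) : Continuous fun z => evalAt L z p := by
  refine continuous_pi fun j => ?_
  unfold evalAt dotProduct
  fun_prop

lemma continuous_partitionSum [Fintype ι] [Fintype P] (hc : ∀ p, Continuous (Φ p)) (L : P → J → ι → ℝ) :
    Continuous fun z => partitionSum β Φ (evalAt L z) :=
  continuous_finsetSum _ fun p _ => Real.continuous_exp.comp
    (continuous_const.mul ((hc p).comp (continuous_evalAt L p)))

lemma abs_sum_mul_le_card [Fintype J] {d v : J → ℝ} {c : ℝ} (hd : ∀ j, |d j| ≤ 1) (hv : ∀ j, |v j| ≤ c) :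
    |∑ j, d j * v j| ≤ Fintype.card J * c := by
  refine (Finset.abs_sum_le_sum_abs _ _).trans ?_
  refine (Finset.sum_le_card_nsmul _ _ c fun j _ => ?_).trans (by simp)
  rw [abs_mul]
  exact (mul_le_of_le_one_left (abs_nonneg _) (hd j)).trans (hv j)

/-- The Gibbs weights are at most one. -/
lemma exp_mul_partitionSum_rpow_le [Fintype P] [Nonempty P] (y : P → J → ℝ) (p : P) :
    partitionSum β Φ y ^ (r - 1) * Real.exp (-β * Φ p (y p)) ≤ partitionSum β Φ y ^ r := by
  have hS := partitionSum_pos (β := β) (Φ := Φ) y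
  calc partitionSum β Φ y ^ (r - 1) * Real.exp (-β * Φ p (y p))
      ≤ partitionSum β Φ y ^ (r - 1) * partitionSum β Φ y := by
        gcongr; exact exp_le_partitionSum y p
    _ = partitionSum β Φ y ^ r := by
        rw [Real.rpow_sub_one hS.ne', div_mul_cancel₀ _ hS.ne']

lemma abs_weight_le [Fintype P] [Nonempty P] (hD1 : ∀ p y j, |D p y j| ≤ 1) (y : P → J → ℝ)
    (p : P) (j : J) :
    |partitionSum β Φ y ^ (r - 1) * (Real.exp (-β * Φ p (y p)) * D p (y p) j)| ≤
      partitionSum β Φ y ^ r := by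
  have hS := partitionSum_pos (β := β) (Φ := Φ) y
  rw [← mul_assoc, abs_mul, abs_of_pos (by positivity)]
  exact (mul_le_of_le_one_right (by positivity) (hD1 _ _ _)).trans
    (exp_mul_partitionSum_rpow_le _ p)

lemma exists_abs_family_le [Finite ι] [Finite J] [Finite P] (L : P → J → ι → ℝ) :
    ∃ M, 0 ≤ M ∧ ∀ p j i, |L p j i| ≤ M := by
  obtain ⟨M, hM⟩ := Finite.exists_le fun x : P × J × ι => |L x.1 x.2.1 x.2.2|
  exact ⟨max M 0, le_max_right _ _, fun p j i => (hM (p, j, i)).trans (le_max_left _ _)⟩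

variable [Fintype ι] [Fintype J] [Fintype P] [Nonempty P]

/-- The exponential growth bound that dominates all the integrands of the interpolation. -/
lemma partitionSum_rpow_le (hβ : 0 ≤ β) (hK : 0 ≤ K) (hM : 0 ≤ M) (hr0 : 0 ≤ r) (hr1 : r ≤ 1)
    (hΦK : ∀ p y, |Φ p y| ≤ K * (1 + ∑ j, |y j|)) {L : P → J → ι → ℝ}
    (hL : ∀ p j i, |L p j i| ≤ M) (z : ι → ℝ) :
    partitionSum β Φ (evalAt L z) ^ r ≤
      (1 + Fintype.card P * Real.exp (β * K)) *
        Real.exp (β * K * (Fintype.card J * M) * ∑ i, |z i|) := by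
  have he : ∀ p, Real.exp (-β * Φ p (evalAt L z p)) ≤
      Real.exp (β * K) * Real.exp (β * K * (Fintype.card J * M) * ∑ i, |z i|) := by
    intro p
    rw [← Real.exp_add]
    refine Real.exp_le_exp.2 ?_
    have h1 : ∑ j, |evalAt L z p j| ≤ (Fintype.card J * M) * ∑ i, |z i| := by
      refine (Finset.sum_le_card_nsmul _ _ (M * ∑ i, |z i|) fun j _ => ?_).trans
        (by simp [mul_assoc])
      exact abs_dotProduct_le_mul_sum (hL p j) z
    have h3 := (neg_le_abs _).trans (hΦK p (evalAt L z p))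
    have h4 : -Φ p (evalAt L z p) ≤ K * (1 + (Fintype.card J * M) * ∑ i, |z i|) :=
      h3.trans (by gcongr)
    have := mul_le_mul_of_nonneg_left h4 hβ
    linarith
  have h1 : partitionSum β Φ (evalAt L z) ≤ Fintype.card P *
      (Real.exp (β * K) * Real.exp (β * K * (Fintype.card J * M) * ∑ i, |z i|)) :=
    (Finset.sum_le_card_nsmul _ _ _ fun p _ => he p).trans (by simp)
  have h2 : partitionSum β Φ (evalAt L z) ^ r ≤ 1 + partitionSum β Φ (evalAt L z) := by
    have hp := partitionSum_pos (β := β) (Φ := Φ) (evalAt L z)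
    rcases le_total (partitionSum β Φ (evalAt L z)) 1 with h | h
    · exact (Real.rpow_le_one hp.le h hr0).trans (by linarith)
    · exact ((Real.rpow_le_rpow_of_exponent_le h hr1).trans (by simp)).trans
        (le_add_of_nonneg_left zero_le_one)
  have h5 : 1 ≤ Real.exp (β * K * (Fintype.card J * M) * ∑ i, |z i|) :=
    Real.one_le_exp (by positivity)
  nlinarith

lemma integrable_stdGaussian_of_le {F : (ι → ℝ) → ℝ} (hF : Continuous F) {c C : ℝ}
    (h : ∀ z, |F z| ≤ c * ((1 + ∑ i, |z i|) * Real.exp (C * ∑ i, |z i|))) :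
    Integrable F (stdGaussian ι) := by
  refine Integrable.mono' ((integrable_exp_sum_abs_stdGaussian (ι := ι) (1 + C)).const_mul |c|)
    hF.aestronglyMeasurable (ae_of_all _ fun z => ?_)
  refine (h z).trans ?_
  have h0 : 0 ≤ ∑ i, |z i| := Finset.sum_nonneg fun i _ => abs_nonneg _
  have h1 : 1 + ∑ i, |z i| ≤ Real.exp (∑ i, |z i|) := by
    rw [add_comm]; exact Real.add_one_le_exp _
  rw [add_mul 1 C, one_mul, Real.exp_add]
  gcongr
  exact le_abs_self c


lemma integrable_partitionSum_rpow
    (hβ : 0 ≤ β) (hK : 0 ≤ K) (hr0 : 0 ≤ r) (hr1 : r ≤ 1) (hΦc : ∀ p, Continuous (Φ p))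
    (hΦK : ∀ p y, |Φ p y| ≤ K * (1 + ∑ j, |y j|)) (L : P → J → ι → ℝ) :
    Integrable (fun z => partitionSum β Φ (evalAt L z) ^ r) (stdGaussian ι) := by
  obtain ⟨M, hM, hL⟩ := exists_abs_family_le L
  refine integrable_stdGaussian_of_le
    ((continuous_partitionSum hΦc L).rpow_const fun z => Or.inl (partitionSum_pos _).ne')
    (c := 1 + Fintype.card P * Real.exp (β * K))
    (C := β * K * (Fintype.card J * M)) fun z => ?_
  rw [abs_of_nonneg (Real.rpow_nonneg (partitionSum_pos _).le _)]
  refine (partitionSum_rpow_le hβ hK hM hr0 hr1 hΦK hL z).trans ?_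
  gcongr
  refine le_mul_of_one_le_left (Real.exp_pos _).le ?_
  exact le_add_of_nonneg_right (Finset.sum_nonneg fun i _ => abs_nonneg _)

lemma integrable_velocity_mul
    (hβ : 0 ≤ β) (hK : 0 ≤ K) (hr0 : 0 ≤ r) (hr1 : r ≤ 1) (hΦc : ∀ p, Continuous (Φ p))
    (hDc : ∀ p j, Continuous fun y => D p y j) (hD1 : ∀ p y j, |D p y j| ≤ 1)
    (hΦK : ∀ p y, |Φ p y| ≤ K * (1 + ∑ j, |y j|)) (L : P → J → ι → ℝ) (u : ι → ℝ)
    (p : P) (j : J) :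
    Integrable (fun z => (u ⬝ᵥ z) * (partitionSum β Φ (evalAt L z) ^ (r - 1) *
        (Real.exp (-β * Φ p (evalAt L z p)) * D p (evalAt L z p) j))) (stdGaussian ι) := by
  obtain ⟨M, hM, hL⟩ := exists_abs_family_le L
  obtain ⟨c, hc, hcu⟩ : ∃ c, 0 ≤ c ∧ ∀ i, |u i| ≤ c := by
    obtain ⟨c, hc⟩ := Finite.exists_le fun i => |u i|
    exact ⟨max c 0, le_max_right _ _, fun i => (hc i).trans (le_max_left _ _)⟩
  refine integrable_stdGaussian_of_le (Continuous.mul (by unfold dotProduct; fun_prop)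
      (((continuous_partitionSum hΦc L).rpow_const fun z => Or.inl (partitionSum_pos _).ne').mul
        ((Real.continuous_exp.comp (continuous_const.mul
          ((hΦc p).comp (continuous_evalAt L p)))).mul ((hDc p j).comp (continuous_evalAt L p)))))
    (c := c * (1 + Fintype.card P * Real.exp (β * K)))
    (C := β * K * (Fintype.card J * M)) fun z => ?_
  rw [abs_mul]
  have h0 : 0 ≤ ∑ i, |z i| := Finset.sum_nonneg fun i _ => abs_nonneg _
  calc _ ≤ (c * ∑ i, |z i|) * ((1 + Fintype.card P * Real.exp (β * K)) *
          Real.exp (β * K * (Fintype.card J * M) * ∑ i, |z i|)) := by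
        gcongr
        · exact abs_dotProduct_le_mul_sum hcu z
        · exact (abs_weight_le hD1 _ p j).trans (partitionSum_rpow_le hβ hK hM hr0 hr1 hΦK hL z)
    _ = (c * (1 + Fintype.card P * Real.exp (β * K))) *
          ((∑ i, |z i|) * Real.exp (β * K * (Fintype.card J * M) * ∑ i, |z i|)) := by ring
    _ ≤ _ := by gcongr; linarith

/-- One term of the interpolation formula: Stein's lemma in a direction `u` that does not move the
`p`-th point of the process. The velocity of the path at `p` is such a direction, because the
covariances within one index do not change along the path. The integrability of the new integrand is
part of the statement. -/
lemma integral_velocity_mul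
    (hβ : 0 ≤ β) (hK : 0 ≤ K) (hr0 : 0 ≤ r) (hr1 : r ≤ 1)
    (hΦ : ∀ p y, HasFDerivAt (Φ p) (∑ j, D p y j • ContinuousLinearMap.proj (R := ℝ) j) y)
    (hDc : ∀ p j, Continuous fun y => D p y j) (hD1 : ∀ p y j, |D p y j| ≤ 1)
    (hΦK : ∀ p y, |Φ p y| ≤ K * (1 + ∑ j, |y j|))
    {L : P → J → ι → ℝ} {u : ι → ℝ} (p : P) (j : J) (hu : ∀ k, L p k ⬝ᵥ u = 0) :
    Integrable (fun z => β * (1 - r) * partitionSum β Φ (evalAt L z) ^ (r - 2) *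
        (Real.exp (-β * Φ p (evalAt L z p)) * D p (evalAt L z p) j *
          ∑ q, Real.exp (-β * Φ q (evalAt L z q)) *
            ∑ k, D q (evalAt L z q) k * (L q k ⬝ᵥ u))) (stdGaussian ι) ∧
    ∫ z, (u ⬝ᵥ z) * (partitionSum β Φ (evalAt L z) ^ (r - 1) *
        (Real.exp (-β * Φ p (evalAt L z p)) * D p (evalAt L z p) j)) ∂stdGaussian ι =
      ∫ z, β * (1 - r) * partitionSum β Φ (evalAt L z) ^ (r - 2) *
        (Real.exp (-β * Φ p (evalAt L z p)) * D p (evalAt L z p) j *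
          ∑ q, Real.exp (-β * Φ q (evalAt L z q)) *
            ∑ k, D q (evalAt L z q) k * (L q k ⬝ᵥ u)) ∂stdGaussian ι := by
  have hΦc : ∀ p, Continuous (Φ p) := fun p =>
    continuous_iff_continuousAt.2 fun y => (hΦ p y).continuousAt
  have hDL : ∀ q k, Continuous fun z => D q (evalAt L z q) k := fun q k =>
    (hDc q k).comp (continuous_evalAt L q)
  have hEL : ∀ q, Continuous fun z => Real.exp (-β * Φ q (evalAt L z q)) := fun q =>
    Real.continuous_exp.comp (continuous_const.mul ((hΦc q).comp (continuous_evalAt L q)))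
  have hSL : ∀ a : ℝ, Continuous fun z => partitionSum β Φ (evalAt L z) ^ a := fun a =>
    (continuous_partitionSum hΦc L).rpow_const fun z => Or.inl (partitionSum_pos _).ne'
  obtain ⟨M, hM, hL⟩ := exists_abs_family_le L
  obtain ⟨c', hc', hcL⟩ : ∃ c', 0 ≤ c' ∧ ∀ q k, |L q k ⬝ᵥ u| ≤ c' := by
    obtain ⟨c, hc⟩ := Finite.exists_le fun x : P × J => |L x.1 x.2 ⬝ᵥ u|
    exact ⟨max c 0, le_max_right _ _, fun p j => (hc (p, j)).trans (le_max_left _ _)⟩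
  have hbound := partitionSum_rpow_le hβ hK hM hr0 hr1 hΦK hL
  set c₁ := 1 + Fintype.card P * Real.exp (β * K)
  set c₂ := β * K * (Fintype.card J * M)
  have hc₁ : 0 ≤ c₁ := by positivity
  have hint : Integrable (fun z => β * (1 - r) * partitionSum β Φ (evalAt L z) ^ (r - 2) *
        (Real.exp (-β * Φ p (evalAt L z p)) * D p (evalAt L z p) j *
          ∑ q, Real.exp (-β * Φ q (evalAt L z q)) *
            ∑ k, D q (evalAt L z q) k * (L q k ⬝ᵥ u))) (stdGaussian ι) := by
    refine integrable_stdGaussian_of_le ?_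
      (c := β * (1 - r) * (Fintype.card J * c') * c₁) (C := c₂) fun z => ?_
    · exact (continuous_const.mul (hSL _)).mul (((hEL p).mul (hDL p j)).mul
        (continuous_finsetSum _ fun q _ => (hEL q).mul
          (continuous_finsetSum _ fun k _ => (hDL q k).mul continuous_const)))
    have hS := partitionSum_pos (β := β) (Φ := Φ) (evalAt L z)
    have h1r : 0 ≤ 1 - r := by linarith
    have h1 : |∑ q, Real.exp (-β * Φ q (evalAt L z q)) *
        ∑ k, D q (evalAt L z q) k * (L q k ⬝ᵥ u)| ≤
        partitionSum β Φ (evalAt L z) * (Fintype.card J * c') := by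
      rw [partitionSum, Finset.sum_mul]
      refine (Finset.abs_sum_le_sum_abs _ _).trans (Finset.sum_le_sum fun q _ => ?_)
      rw [abs_mul, Real.abs_exp]
      gcongr
      exact abs_sum_mul_le_card (hD1 q _) (hcL q)
    rw [abs_mul, abs_of_nonneg (by positivity), abs_mul, abs_mul, Real.abs_exp]
    calc β * (1 - r) * partitionSum β Φ (evalAt L z) ^ (r - 2) *
          (Real.exp (-β * Φ p (evalAt L z p)) * |D p (evalAt L z p) j| * _)
        ≤ β * (1 - r) * partitionSum β Φ (evalAt L z) ^ (r - 2) *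
          (partitionSum β Φ (evalAt L z) * 1 *
            (partitionSum β Φ (evalAt L z) * (Fintype.card J * c'))) := by
          gcongr
          · exact exp_le_partitionSum _ p
          · exact hD1 _ _ _
      _ = β * (1 - r) * (Fintype.card J * c') * partitionSum β Φ (evalAt L z) ^ r := by
          rw [show r = r - 2 + 1 + 1 by ring, Real.rpow_add_one hS.ne', Real.rpow_add_one hS.ne']
          ring_nf
      _ ≤ β * (1 - r) * (Fintype.card J * c') * (c₁ * Real.exp (c₂ * ∑ i, |z i|)) := by
          gcongr; exact hbound z
      _ ≤ _ := by
          rw [mul_assoc _ c₁]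
          gcongr
          refine le_mul_of_one_le_left (Real.exp_pos _).le ?_
          exact le_add_of_nonneg_right (Finset.sum_nonneg fun i _ => abs_nonneg _)
  refine ⟨hint, integral_dotProduct_mul_stdGaussian (fun z => ?_) ?_ hint ?_⟩
  · -- the line derivative: only the partition function varies along `u`
    have hconst : ∀ s : ℝ, evalAt L (z + s • u) p = evalAt L z p := fun s => by
      funext k; simp [evalAt, dotProduct_add, dotProduct_smul, hu]
    have h := hasDerivAt_partitionSum (β := β) hΦ (t := 0)
      (y := fun s => evalAt L (z + s • u)) (y' := fun q k => L q k ⬝ᵥ u) fun q k => by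
        simp only [evalAt, dotProduct_add, dotProduct_smul, smul_eq_mul]
        simpa using ((hasDerivAt_id (0 : ℝ)).mul_const (L q k ⬝ᵥ u)).const_add (L q k ⬝ᵥ z)
    unfold HasLineDerivAt
    simp only [hconst]
    refine ((h.rpow_const (p := r - 1) (Or.inl (partitionSum_pos _).ne')).mul_const _).congr_deriv ?_
    simp only [zero_smul, add_zero]
    rw [show r - 1 - 1 = r - 2 by ring]
    ring
  · refine integrable_stdGaussian_of_le ((hSL _).mul ((hEL p).mul (hDL p j))) (c := c₁) (C := c₂)
      fun z => ?_
    refine ((abs_weight_le hD1 _ p j).trans (hbound z)).trans ?_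
    gcongr
    refine le_mul_of_one_le_left (Real.exp_pos _).le ?_
    exact le_add_of_nonneg_right (Finset.sum_nonneg fun i _ => abs_nonneg _)
  · exact integrable_velocity_mul hβ hK hr0 hr1 hΦc hDc hD1 hΦK L u p j

/-- **Gaussian comparison for vector-valued processes**, in the form of Gordon and Kahane. The two
Gaussian processes `p ↦ (A p j ⬝ᵥ z)_j` and `p ↦ (B p j ⬝ᵥ z)_j` have the same covariance at each
index `p`; the potentials `Φ_p` are continuously differentiable with gradient `D_p`. If the gradients
correlate the increments of the covariance nonnegatively, then the soft minimum of the `Φ_p` is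
larger for the process `A`, in the sense that its negative exponential moment is smaller. -/
theorem integral_partitionSum_rpow_le
    (hβ : 0 ≤ β) (hK : 0 ≤ K) (hr0 : 0 ≤ r) (hr1 : r ≤ 1)
    (hΦ : ∀ p y, HasFDerivAt (Φ p) (∑ j, D p y j • ContinuousLinearMap.proj (R := ℝ) j) y)
    (hDc : ∀ p j, Continuous fun y => D p y j) (hD1 : ∀ p y j, |D p y j| ≤ 1)
    (hΦK : ∀ p y, |Φ p y| ≤ K * (1 + ∑ j, |y j|))
    (hAB : ∀ p q j k, A p j ⬝ᵥ B q k = 0)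
    (hsame : ∀ p j k, A p j ⬝ᵥ A p k = B p j ⬝ᵥ B p k)
    (hcross : ∀ p q y y', 0 ≤ ∑ j, ∑ k, D p y j * D q y' k *
      (A p j ⬝ᵥ A q k - B p j ⬝ᵥ B q k)) :
    ∫ z, partitionSum β Φ (evalAt A z) ^ r ∂stdGaussian ι ≤
      ∫ z, partitionSum β Φ (evalAt B z) ^ r ∂stdGaussian ι := by
  have hΦc : ∀ p, Continuous (Φ p) := fun p =>
    continuous_iff_continuousAt.2 fun y => (hΦ p y).continuousAt
  obtain ⟨M, hM, hABM⟩ : ∃ M, 0 ≤ M ∧ ∀ p j i, |A p j i| + |B p j i| ≤ M := by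
    obtain ⟨M, hM⟩ := Finite.exists_le fun x : P × J × ι =>
      |A x.1 x.2.1 x.2.2| + |B x.1 x.2.1 x.2.2|
    exact ⟨max M 0, le_max_right _ _, fun p j i => (hM (p, j, i)).trans (le_max_left _ _)⟩
  set c₁ := 1 + Fintype.card P * Real.exp (β * K)
  set c₂ := β * K * (Fintype.card J * M)
  have hc₁ : 0 ≤ c₁ := by positivity
  have hbound : ∀ θ z, partitionSum β Φ (evalAt (arc A B θ) z) ^ r ≤
      c₁ * Real.exp (c₂ * ∑ i, |z i|) := fun θ z =>
    partitionSum_rpow_le hβ hK hM hr0 hr1 hΦK (abs_arc_le hABM θ) z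
  have hSc : ∀ θ (a : ℝ), Continuous fun z => partitionSum β Φ (evalAt (arc A B θ) z) ^ a :=
    fun θ a => (continuous_partitionSum hΦc _).rpow_const fun z => Or.inl (partitionSum_pos _).ne'
  set G : ℝ → ℝ := fun θ => ∫ z, partitionSum β Φ (evalAt (arc A B θ) z) ^ r ∂stdGaussian ι
  set g : ℝ → (ι → ℝ) → ℝ := fun θ z =>
    -(β * r) * ∑ p, ∑ j, (arcVelocity A B θ p j ⬝ᵥ z) *
      (partitionSum β Φ (evalAt (arc A B θ) z) ^ (r - 1) *
        (Real.exp (-β * Φ p (evalAt (arc A B θ) z p)) * D p (evalAt (arc A B θ) z p) j))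
  have hgi : ∀ θ p j, Integrable (fun z => (arcVelocity A B θ p j ⬝ᵥ z) *
      (partitionSum β Φ (evalAt (arc A B θ) z) ^ (r - 1) *
        (Real.exp (-β * Φ p (evalAt (arc A B θ) z p)) * D p (evalAt (arc A B θ) z p) j)))
      (stdGaussian ι) := fun θ p j =>
    integrable_velocity_mul hβ hK hr0 hr1 hΦc hDc hD1 hΦK _ _ p j
  -- differentiation under the integral sign
  have hG : ∀ θ, HasDerivAt G (∫ z, g θ z ∂stdGaussian ι) θ := by
    intro θ
    refine (hasDerivAt_integral_of_dominated_loc_of_deriv_le (F := fun θ z =>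
      partitionSum β Φ (evalAt (arc A B θ) z) ^ r) (F' := g) (s := Set.univ)
      (bound := fun z => β * r * ∑ _p : P, ∑ _j : J, (M * ∑ i, |z i|) *
        (c₁ * Real.exp (c₂ * ∑ i, |z i|)))
      Filter.univ_mem (Eventually.of_forall fun θ => (hSc θ r).aestronglyMeasurable) ?_ ?_ ?_ ?_ ?_).2
    · exact integrable_partitionSum_rpow hβ hK hr0 hr1 hΦc hΦK _
    · exact ((integrable_finsetSum _ fun p _ => integrable_finsetSum _ fun j _ =>
        hgi θ p j).const_mul _).aestronglyMeasurable
    · refine ae_of_all _ fun z θ' _ => ?_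
      rw [Real.norm_eq_abs, abs_mul, abs_neg, abs_of_nonneg (by positivity)]
      gcongr
      refine (Finset.abs_sum_le_sum_abs _ _).trans (Finset.sum_le_sum fun p _ => ?_)
      refine (Finset.abs_sum_le_sum_abs _ _).trans (Finset.sum_le_sum fun j _ => ?_)
      rw [abs_mul]
      gcongr
      · exact abs_dotProduct_le_mul_sum (abs_arcVelocity_le hABM θ' p j) z
      · exact (abs_weight_le hD1 _ p j).trans (hbound θ' z)
    · refine Integrable.const_mul (integrable_finsetSum _ fun p _ =>
        integrable_finsetSum _ fun j _ => ?_) _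
      refine integrable_stdGaussian_of_le (by fun_prop) (c := M * c₁) (C := c₂) fun z => ?_
      have h0 : 0 ≤ ∑ i, |z i| := Finset.sum_nonneg fun i _ => abs_nonneg _
      rw [abs_of_nonneg (by positivity)]
      calc _ = M * c₁ * ((∑ i, |z i|) * Real.exp (c₂ * ∑ i, |z i|)) := by ring
        _ ≤ _ := by gcongr; linarith
    · refine ae_of_all _ fun z θ' _ => ?_
      have h := hasDerivAt_partitionSum (β := β) hΦ (t := θ')
        (y := fun s => evalAt (arc A B s) z) (y' := evalAt (arcVelocity A B θ') z) fun p j => by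
          simp only [evalAt, arc, arcVelocity, add_dotProduct, smul_dotProduct, smul_eq_mul]
          exact ((Real.hasDerivAt_cos θ').mul_const _).add ((Real.hasDerivAt_sin θ').mul_const _)
      refine (h.rpow_const (p := r) (Or.inl (partitionSum_pos _).ne')).congr_deriv ?_
      simp only [g, evalAt, Finset.mul_sum, Finset.sum_mul]
      refine Finset.sum_congr rfl fun p _ => Finset.sum_congr rfl fun j _ => ?_
      ring
  -- the derivative is nonpositive, by Stein's lemma applied to each of its terms
  have hg : ∀ θ ∈ Set.Icc 0 (Real.pi / 2), ∫ z, g θ z ∂stdGaussian ι ≤ 0 := by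
    intro θ hθ
    have hsin : 0 ≤ Real.sin θ :=
      Real.sin_nonneg_of_nonneg_of_le_pi hθ.1 (hθ.2.trans (by linarith [Real.pi_pos]))
    have hcos : 0 ≤ Real.cos θ :=
      Real.cos_nonneg_of_neg_pi_div_two_le_of_le (by linarith [Real.pi_pos, hθ.1]) hθ.2
    simp only [g]
    rw [integral_const_mul, integral_finsetSum _ fun p _ => integrable_finsetSum _ fun j _ =>
      hgi θ p j]
    refine mul_nonpos_of_nonpos_of_nonneg (by simpa using mul_nonneg hβ hr0) ?_
    refine Finset.sum_nonneg fun p _ => ?_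
    have hst := fun j => integral_velocity_mul (j := j) hβ hK hr0 hr1 hΦ hDc hD1 hΦK
      (L := arc A B θ) (u := arcVelocity A B θ p j) p fun k => by
        rw [dotProduct_comm, arcVelocity_dotProduct_arc hAB, hsame, sub_self, mul_zero]
    rw [integral_finsetSum _ fun j _ => hgi θ p j, Finset.sum_congr rfl fun j _ => (hst j).2,
      ← integral_finsetSum _ fun j _ => (hst j).1]
    refine integral_nonneg fun z => ?_
    have hS := partitionSum_pos (β := β) (Φ := Φ) (evalAt (arc A B θ) z)
    have h1r : 0 ≤ 1 - r := by linarith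
    dsimp only [Pi.zero_apply]
    rw [← Finset.mul_sum]
    refine mul_nonneg (by positivity) ?_
    simp_rw [dotProduct_comm (arc A B θ _ _), arcVelocity_dotProduct_arc hAB]
    have key : ∑ j, Real.exp (-β * Φ p (evalAt (arc A B θ) z p)) *
        D p (evalAt (arc A B θ) z p) j *
          ∑ q, Real.exp (-β * Φ q (evalAt (arc A B θ) z q)) *
            ∑ k, D q (evalAt (arc A B θ) z q) k *
              (Real.sin θ * Real.cos θ * (A p j ⬝ᵥ A q k - B p j ⬝ᵥ B q k)) =
        ∑ q, Real.exp (-β * Φ p (evalAt (arc A B θ) z p)) *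
          Real.exp (-β * Φ q (evalAt (arc A B θ) z q)) * (Real.sin θ * Real.cos θ) *
            ∑ j, ∑ k, D p (evalAt (arc A B θ) z p) j * D q (evalAt (arc A B θ) z q) k *
              (A p j ⬝ᵥ A q k - B p j ⬝ᵥ B q k) := by
      simp only [Finset.mul_sum]
      rw [Finset.sum_comm]
      refine Finset.sum_congr rfl fun q _ => Finset.sum_congr rfl fun j _ =>
        Finset.sum_congr rfl fun k _ => ?_
      ring
    rw [key]
    refine Finset.sum_nonneg fun q _ => mul_nonneg (by positivity) (hcross p q _ _)
  have hanti : AntitoneOn G (Set.Icc 0 (Real.pi / 2)) := by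
    refine antitoneOn_of_deriv_nonpos (convex_Icc _ _)
      (fun θ _ => (hG θ).continuousAt.continuousWithinAt)
      (fun θ _ => (hG θ).differentiableAt.differentiableWithinAt) fun θ hθ => ?_
    rw [(hG θ).deriv]
    exact hg θ (interior_subset hθ)
  have hpi : (0 : ℝ) ≤ Real.pi / 2 := by positivity
  have h := hanti (Set.left_mem_Icc.2 hpi) (Set.right_mem_Icc.2 hpi) hpi
  have hA : arc A B (Real.pi / 2) = A := by funext p j; simp [arc]
  have hB : arc A B 0 = B := by funext p j; simp [arc]
  simpa only [G, hA, hB] using h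

end Comparison

/-! ### Products of Gaussian measures -/

section Factor

variable {α' β' : Type*} [Fintype α'] [Fintype β']

lemma measurePreserving_stdGaussian_sum :
    MeasurePreserving (MeasurableEquiv.sumPiEquivProdPi fun _ : α' ⊕ β' => ℝ)
      (stdGaussian (α' ⊕ β')) ((stdGaussian α').prod (stdGaussian β')) :=
  measurePreserving_sumPiEquivProdPi fun _ => gaussianReal 0 1

lemma integral_stdGaussian_sum_mul (F : (α' → ℝ) → ℝ) (G : (β' → ℝ) → ℝ) :
    ∫ z, F (fun a => z (.inl a)) * G (fun b => z (.inr b)) ∂stdGaussian (α' ⊕ β') =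
      (∫ x, F x ∂stdGaussian α') * ∫ y, G y ∂stdGaussian β' := by
  rw [← integral_prod_mul]
  exact measurePreserving_stdGaussian_sum.integral_comp' (fun z => F z.1 * G z.2)

lemma integrable_stdGaussian_sum_mul {F : (α' → ℝ) → ℝ} {G : (β' → ℝ) → ℝ}
    (hF : Integrable F (stdGaussian α')) (hG : Integrable G (stdGaussian β')) :
    Integrable (fun z : α' ⊕ β' → ℝ => F (fun a => z (.inl a)) * G (fun b => z (.inr b)))
      (stdGaussian (α' ⊕ β')) :=
  measurePreserving_stdGaussian_sum.integrable_comp_of_integrable (hF.mul_prod hG)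

lemma measurePreserving_stdGaussian_curry (m n : ℕ) :
    MeasurePreserving (MeasurableEquiv.curry (Fin m) (Fin n) ℝ) (stdGaussian (Fin m × Fin n))
      (gaussianMatrix m n) := by
  refine ⟨MeasurableEquiv.measurable _, ?_⟩
  have h := Measure.infinitePi_map_curry (fun (_ : Fin m) (_ : Fin n) => gaussianReal 0 1)
  simp only [Measure.infinitePi_eq_pi] at h
  exact h

lemma integral_exp_mul_stdGaussian_unit (c : ℝ) :
    ∫ z : Unit → ℝ, Real.exp (c * z ()) ∂stdGaussian Unit = Real.exp (c ^ 2 / 2) := by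
  have h := integral_fintype_prod_eq_prod (ι := Unit) (μ := fun _ => gaussianReal 0 1)
    (fun _ x => Real.exp (c * x))
  simp only [Finset.univ_unique, Finset.prod_singleton] at h
  rw [stdGaussian]
  refine h.trans ?_
  have := congrFun (mgf_fun_id_gaussianReal (μ := 0) (v := 1)) c
  simpa [mgf] using this

end Factor

/-! ### The distance to the feasible set -/

section Residual

variable {m : ℕ}

/-- The Euclidean norm of the violations `(κ - y_i)₊` of the constraints `κ ≤ y_i` picked by `d`,
smoothed to `√(ε² + ∑_i d_i (κ - y_i)₊²)`. For `ε = 0` it is the distance of `y` to the set of the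
vectors that satisfy these constraints; for `ε > 0` it is continuously differentiable. -/
noncomputable def residual (κ ε : ℝ) (d y : Fin m → ℝ) : ℝ :=
  √(ε ^ 2 + ∑ i, d i * max (κ - y i) 0 ^ 2)

lemma hasDerivAt_max_zero_sq (u : ℝ) :
    HasDerivAt (fun u : ℝ => max u 0 ^ 2) (2 * max u 0) u := by
  rcases lt_trichotomy u 0 with h | rfl | h
  · rw [max_eq_right h.le, mul_zero]
    refine (hasDerivAt_const u (0 : ℝ)).congr_of_eventuallyEq ?_
    filter_upwards [Iio_mem_nhds h] with v hv
    simp [max_eq_right (le_of_lt (Set.mem_Iio.1 hv))]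
  · rw [hasDerivAt_iff_isLittleO]
    have h2 : (fun x : ℝ => x ^ 2) =o[𝓝 0] fun x : ℝ => x := by
      simpa using Asymptotics.isLittleO_pow_pow (𝕜 := ℝ) (m := 1) (n := 2) (by norm_num)
    simp only [max_self, sub_zero, mul_zero, smul_zero]
    refine Asymptotics.IsBigO.trans_isLittleO (Asymptotics.IsBigO.of_bound 1 ?_) h2
    refine Eventually.of_forall fun x => ?_
    simp only [Real.norm_eq_abs, abs_pow, one_mul]
    norm_num
    rcases le_total x 0 with h | h
    · rw [max_eq_right h]; simpa using sq_nonneg x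
    · rw [max_eq_left h]
  · rw [max_eq_left h.le]
    refine ((hasDerivAt_pow 2 u).congr_deriv (by simp)).congr_of_eventuallyEq ?_
    filter_upwards [Ioi_mem_nhds h] with v hv
    rw [max_eq_left (le_of_lt (Set.mem_Ioi.1 hv))]

variable {κ ε : ℝ} {d : Fin m → ℝ}

lemma sum_violation_nonneg (hd : ∀ i, 0 ≤ d i) (y : Fin m → ℝ) :
    0 ≤ ∑ i, d i * max (κ - y i) 0 ^ 2 :=
  Finset.sum_nonneg fun i _ => mul_nonneg (hd i) (sq_nonneg _)

lemma residual_pos (hε : 0 < ε) (hd : ∀ i, 0 ≤ d i) (y : Fin m → ℝ) : 0 < residual κ ε d y :=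
  Real.sqrt_pos.2 (by have := sum_violation_nonneg (κ := κ) hd y; positivity)

lemma continuous_residual : Continuous (residual κ ε d) := by
  unfold residual
  fun_prop

lemma residual_zero_le (y : Fin m → ℝ) : residual κ 0 d y ≤ residual κ ε d y :=
  Real.sqrt_le_sqrt (by nlinarith [sq_nonneg ε])

lemma residual_le_add (hε : 0 ≤ ε) (hd : ∀ i, 0 ≤ d i) (y : Fin m → ℝ) :
    residual κ ε d y ≤ ε + residual κ 0 d y := by
  have h := sum_violation_nonneg (κ := κ) hd y
  refine Real.sqrt_le_iff.2 ⟨add_nonneg hε (Real.sqrt_nonneg _), ?_⟩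
  have h2 : residual κ 0 d y ^ 2 = ∑ i, d i * max (κ - y i) 0 ^ 2 := by
    rw [residual, Real.sq_sqrt (by simpa using h)]; ring
  nlinarith [mul_nonneg hε (Real.sqrt_nonneg (0 ^ 2 + ∑ i, d i * max (κ - y i) 0 ^ 2)),
    show residual κ 0 d y = √(0 ^ 2 + ∑ i, d i * max (κ - y i) 0 ^ 2) from rfl]

lemma hasFDerivAt_residual (hε : 0 < ε) (hd : ∀ i, 0 ≤ d i) (y : Fin m → ℝ) :
    HasFDerivAt (residual κ ε d) (∑ i, (-(d i * max (κ - y i) 0) / residual κ ε d y) •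
      ContinuousLinearMap.proj (R := ℝ) (φ := fun _ : Fin m => ℝ) i) y := by
  have hterm : ∀ i, HasFDerivAt (fun y : Fin m → ℝ => d i * max (κ - y i) 0 ^ 2)
      ((d i * (2 * max (κ - y i) 0 * (-1))) •
        ContinuousLinearMap.proj (R := ℝ) (φ := fun _ : Fin m => ℝ) i) y := by
    intro i
    have h1 : HasDerivAt (fun t : ℝ => d i * max (κ - t) 0 ^ 2)
        (d i * (2 * max (κ - y i) 0 * (-1))) (y i) :=
      ((hasDerivAt_max_zero_sq (κ - y i)).comp (y i)
        ((hasDerivAt_id (y i)).const_sub κ)).const_mul (d i)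
    exact HasDerivAt.comp_hasFDerivAt (h₂ := fun t : ℝ => d i * max (κ - t) 0 ^ 2) y h1
      (hasFDerivAt_apply i y)
  have hsum := (HasFDerivAt.fun_sum fun i (_ : i ∈ Finset.univ) => hterm i).const_add (ε ^ 2)
  have hne : ε ^ 2 + ∑ i, d i * max (κ - y i) 0 ^ 2 ≠ 0 := by
    have := sum_violation_nonneg (κ := κ) hd y; positivity
  refine (hsum.sqrt hne).congr_fderiv ?_
  rw [Finset.smul_sum]
  refine Finset.sum_congr rfl fun i _ => ?_
  rw [smul_smul]
  congr 1
  rw [residual]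
  field_simp

lemma abs_residual_le (hε : 0 ≤ ε) (hd1 : ∀ i, d i ≤ 1) (y : Fin m → ℝ) :
    |residual κ ε d y| ≤ ε + m * |κ| + ∑ i, |y i| := by
  have hb : ∑ i, |κ - y i| ≤ m * |κ| + ∑ i, |y i| := by
    refine (Finset.sum_le_sum fun i _ => abs_sub κ (y i)).trans ?_
    simp [Finset.sum_add_distrib]
  have hs0 : 0 ≤ ∑ i, |κ - y i| := Finset.sum_nonneg fun i _ => abs_nonneg _
  rw [residual, abs_of_nonneg (Real.sqrt_nonneg _)]
  refine le_trans ?_ (show ε + ∑ i, |κ - y i| ≤ _ by linarith)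
  refine Real.sqrt_le_iff.2 ⟨by positivity, ?_⟩
  have h1 : ∑ i, d i * max (κ - y i) 0 ^ 2 ≤ ∑ i, |κ - y i| ^ 2 := by
    refine Finset.sum_le_sum fun i _ => ?_
    have h3 : max (κ - y i) 0 ^ 2 ≤ |κ - y i| ^ 2 :=
      pow_le_pow_left₀ (le_max_right _ _) (max_le (le_abs_self _) (abs_nonneg _)) 2
    exact (mul_le_of_le_one_left (sq_nonneg _) (hd1 i)).trans h3
  have h2 := Finset.sum_sq_le_sq_sum_of_nonneg (s := Finset.univ)
    (f := fun i => |κ - y i|) fun i _ => abs_nonneg _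
  nlinarith

/-- The smoothed residual is `1`-Lipschitz: its gradient lies in the unit ball. -/
lemma sum_sq_gradient_residual_le (hε : 0 < ε) (hd0 : ∀ i, 0 ≤ d i) (hd1 : ∀ i, d i ≤ 1)
    (y : Fin m → ℝ) :
    ∑ i, (-(d i * max (κ - y i) 0) / residual κ ε d y) ^ 2 ≤ 1 := by
  have hp := residual_pos (κ := κ) hε hd0 y
  have h := sum_violation_nonneg (κ := κ) hd0 y
  simp_rw [div_pow]
  rw [← Finset.sum_div, div_le_one (by positivity), residual, Real.sq_sqrt (by positivity)]
  refine le_trans (Finset.sum_le_sum fun i _ => ?_) (le_add_of_nonneg_left (sq_nonneg ε))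
  rw [neg_sq, mul_pow]
  gcongr
  nlinarith [hd0 i, hd1 i]

end Residual

/-! ### Gordon's comparison for a Gaussian matrix -/

section Gordon

variable {m n : ℕ} {P : Type*}

/-- The coordinates of a Gaussian `m × n` matrix, of Gaussian vectors in `ℝᵐ` and `ℝⁿ`, and of a
Gaussian scalar, all independent. -/
abbrev GordonIndex (m n : ℕ) : Type := (Fin m × Fin n) ⊕ (Fin m ⊕ (Fin n ⊕ Unit))

/-- The process `p ↦ (H X_p, g₀)`, for `H` the matrix and `g₀` the scalar. -/
def matrixFamily (m : ℕ) (X : P → Fin n → ℝ) (p : P) : Fin m ⊕ Unit → GordonIndex m n → ℝ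
  | .inl i => Sum.elim (fun a => if a.1 = i then X p a.2 else 0) 0
  | .inr _ => Sum.elim 0 (Sum.elim 0 (Sum.elim 0 1))

/-- The process `p ↦ (g, ⟨h, X_p⟩)`, for `g` and `h` the vectors in `ℝᵐ` and `ℝⁿ`. -/
def vectorFamily (m : ℕ) (X : P → Fin n → ℝ) (p : P) : Fin m ⊕ Unit → GordonIndex m n → ℝ
  | .inl i => Sum.elim 0 (Sum.elim (Pi.single i 1) 0)
  | .inr _ => Sum.elim 0 (Sum.elim 0 (Sum.elim (X p) 0))

lemma matrixFamily_dotProduct (X : P → Fin n → ℝ) (p q : P) (j k : Fin m ⊕ Unit) :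
    matrixFamily m X p j ⬝ᵥ matrixFamily m X q k =
      match j, k with
      | .inl i, .inl i' => if i = i' then X p ⬝ᵥ X q else 0
      | .inr _, .inr _ => 1
      | _, _ => 0 := by
  rcases j with i | _ <;> rcases k with i' | _ <;>
    simp only [matrixFamily, sumElim_dotProduct_sumElim, zero_dotProduct, dotProduct_zero,
      add_zero, zero_add]
  · simp only [dotProduct, Fintype.sum_prod_type, ite_mul, zero_mul, mul_ite, mul_zero]
    rw [Finset.sum_eq_single i (fun b _ hb => by simp [hb]) (by simp)]
    split_ifs <;> simp_all
  · simp [dotProduct]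

lemma vectorFamily_dotProduct (X : P → Fin n → ℝ) (p q : P) (j k : Fin m ⊕ Unit) :
    vectorFamily m X p j ⬝ᵥ vectorFamily m X q k =
      match j, k with
      | .inl i, .inl i' => if i = i' then 1 else 0
      | .inr _, .inr _ => X p ⬝ᵥ X q
      | _, _ => 0 := by
  rcases j with i | _ <;> rcases k with i' | _ <;>
    simp [vectorFamily, Pi.single_apply, eq_comm]

lemma matrixFamily_dotProduct_vectorFamily (X : P → Fin n → ℝ) (p q : P) (j k : Fin m ⊕ Unit) :
    matrixFamily m X p j ⬝ᵥ vectorFamily m X q k = 0 := by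
  rcases j with i | _ <;> rcases k with i' | _ <;>
    simp [matrixFamily, vectorFamily]

/-- The smoothed residual shifted by the scalar coordinate. -/
noncomputable def gordonPotential (κ ε : ℝ) (d : P → Fin m → ℝ) (p : P) (y : Fin m ⊕ Unit → ℝ) :
    ℝ :=
  residual κ ε (d p) (fun i => y (.inl i)) + y (.inr ())

/-- The gradient of `gordonPotential`. -/
noncomputable def gordonGradient (κ ε : ℝ) (d : P → Fin m → ℝ) (p : P) (y : Fin m ⊕ Unit → ℝ) :
    Fin m ⊕ Unit → ℝ
  | .inl i => -(d p i * max (κ - y (.inl i)) 0) / residual κ ε (d p) (fun i => y (.inl i))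
  | .inr _ => 1

variable {κ ε : ℝ} {d : P → Fin m → ℝ}

lemma hasFDerivAt_gordonPotential (hε : 0 < ε) (hd : ∀ p i, 0 ≤ d p i) (p : P)
    (y : Fin m ⊕ Unit → ℝ) :
    HasFDerivAt (gordonPotential κ ε d p)
      (∑ j, gordonGradient κ ε d p y j •
        ContinuousLinearMap.proj (R := ℝ) (φ := fun _ : Fin m ⊕ Unit => ℝ) j) y := by
  have h1 : HasFDerivAt (fun y : Fin m ⊕ Unit → ℝ => fun i : Fin m => y (.inl i))
      (ContinuousLinearMap.pi fun i => ContinuousLinearMap.proj (R := ℝ)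
        (φ := fun _ : Fin m ⊕ Unit => ℝ) (.inl i)) y :=
    hasFDerivAt_pi.2 fun i => hasFDerivAt_apply (Sum.inl i) y
  refine (((hasFDerivAt_residual hε (hd p) _).comp y h1).add
    (hasFDerivAt_apply (Sum.inr ()) y)).congr_fderiv ?_
  ext v
  simp [gordonGradient]

lemma continuous_gordonGradient (hε : 0 < ε) (hd : ∀ p i, 0 ≤ d p i) (p : P) (j : Fin m ⊕ Unit) :
    Continuous fun y => gordonGradient κ ε d p y j := by
  rcases j with i | _
  · simp only [gordonGradient]
    refine Continuous.div (by fun_prop) (continuous_residual.comp (by fun_prop))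
      fun y => (residual_pos hε (hd p) _).ne'
  · exact continuous_const

lemma abs_gordonGradient_le (hε : 0 < ε) (hd : ∀ p i, 0 ≤ d p i) (hd1 : ∀ p i, d p i ≤ 1) (p : P)
    (y : Fin m ⊕ Unit → ℝ) (j : Fin m ⊕ Unit) : |gordonGradient κ ε d p y j| ≤ 1 := by
  rcases j with i | _
  · rw [← sq_le_one_iff_abs_le_one]
    exact (Finset.single_le_sum (f := fun i => gordonGradient κ ε d p y (.inl i) ^ 2)
      (fun i _ => sq_nonneg _) (Finset.mem_univ i)).trans
      (sum_sq_gradient_residual_le hε (hd p) (hd1 p) _)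
  · simp [gordonGradient]

lemma sum_gordonGradient_mul_le (hε : 0 < ε) (hd : ∀ p i, 0 ≤ d p i) (hd1 : ∀ p i, d p i ≤ 1)
    (p q : P) (y y' : Fin m ⊕ Unit → ℝ) :
    ∑ i, gordonGradient κ ε d p y (.inl i) * gordonGradient κ ε d q y' (.inl i) ≤ 1 := by
  have h1 := sum_sq_gradient_residual_le (κ := κ) hε (hd p) (hd1 p) fun i => y (.inl i)
  have h2 := sum_sq_gradient_residual_le (κ := κ) hε (hd q) (hd1 q) fun i => y' (.inl i)
  refine (Real.sum_mul_le_sqrt_mul_sqrt _ _ _).trans ?_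
  exact mul_le_one₀ (Real.sqrt_le_one.2 h1) (Real.sqrt_nonneg _) (Real.sqrt_le_one.2 h2)

lemma abs_gordonPotential_le (hε : 0 ≤ ε) (hd1 : ∀ p i, d p i ≤ 1) (p : P)
    (y : Fin m ⊕ Unit → ℝ) :
    |gordonPotential κ ε d p y| ≤ (1 + ε + m * |κ|) * (1 + ∑ j, |y j|) := by
  have h := abs_residual_le (κ := κ) hε (hd1 p) fun i => y (.inl i)
  have h2 := abs_add_le (residual κ ε (d p) fun i => y (.inl i)) (y (.inr ()))
  have h3 : ∑ j, |y j| = ∑ i, |y (.inl i)| + |y (.inr ())| := by simp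
  have h4 : 0 ≤ ∑ j, |y j| := Finset.sum_nonneg fun i _ => abs_nonneg _
  have h5 : 0 ≤ (ε + m * |κ|) * ∑ j, |y j| := by positivity
  rw [gordonPotential]
  nlinarith

lemma evalAt_matrixFamily (X : P → Fin n → ℝ) (z : GordonIndex m n → ℝ) (p : P) :
    evalAt (matrixFamily m X) z p =
      Sum.elim (fun i => (fun b => z (.inl (i, b))) ⬝ᵥ X p) fun _ => z (.inr (.inr (.inr ()))) := by
  funext j
  rcases j with i | _
  · simp only [evalAt, matrixFamily, dotProduct, Fintype.sum_sum_type, Sum.elim_inl, Sum.elim_inr,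
      Fintype.sum_prod_type]
    rw [Finset.sum_eq_single i (fun b _ hb => by simp [hb]) (by simp)]
    simp [mul_comm]
  · simp [evalAt, matrixFamily, dotProduct, Fintype.sum_sum_type]

lemma evalAt_vectorFamily (X : P → Fin n → ℝ) (z : GordonIndex m n → ℝ) (p : P) :
    evalAt (vectorFamily m X) z p =
      Sum.elim (fun i => z (.inr (.inl i))) fun _ => X p ⬝ᵥ fun b => z (.inr (.inr (.inl b))) := by
  funext j
  rcases j with i | _
  · simp [evalAt, vectorFamily, dotProduct, Pi.single_apply]
  · simp [evalAt, vectorFamily, dotProduct, Fintype.sum_sum_type]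

lemma sqrt_dotProduct_self_le (h : Fin n → ℝ) : √(h ⬝ᵥ h) ≤ ∑ i, |h i| := by
  have h0 : 0 ≤ ∑ i, |h i| := Finset.sum_nonneg fun i _ => abs_nonneg _
  refine Real.sqrt_le_iff.2 ⟨h0, ?_⟩
  have := Finset.sum_sq_le_sq_sum_of_nonneg (s := Finset.univ) (f := fun i => |h i|)
    fun i _ => abs_nonneg _
  simpa [dotProduct, sq] using this

lemma integrable_exp_norm (c : ℝ) (hc : 0 ≤ c) :
    Integrable (fun h : Fin n → ℝ => Real.exp (c * √(h ⬝ᵥ h))) (stdGaussian (Fin n)) := by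
  refine (integrable_exp_sum_abs_stdGaussian c).mono'
    (Continuous.aestronglyMeasurable (by unfold dotProduct; fun_prop)) (ae_of_all _ fun h => ?_)
  rw [Real.norm_eq_abs, Real.abs_exp]
  gcongr
  exact sqrt_dotProduct_self_le h

lemma integral_exp_scalar (m n : ℕ) (c : ℝ) :
    ∫ z : Fin m ⊕ (Fin n ⊕ Unit) → ℝ, Real.exp (c * z (.inr (.inr ())))
      ∂stdGaussian (Fin m ⊕ (Fin n ⊕ Unit)) = Real.exp (c ^ 2 / 2) := by
  have h1 := integral_stdGaussian_sum_mul (α' := Fin m) (β' := Fin n ⊕ Unit) (fun _ => 1)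
    fun z => Real.exp (c * z (.inr ()))
  have h2 := integral_stdGaussian_sum_mul (α' := Fin n) (β' := Unit) (fun _ => 1)
    fun z => Real.exp (c * z ())
  simp only [one_mul, integral_const, probReal_univ, smul_eq_mul] at h1 h2
  rw [h1, h2, integral_exp_mul_stdGaussian_unit]

variable [Fintype P] [Nonempty P]

/-- Gordon's comparison for the soft minimum of the shifted residuals. -/
lemma integral_partitionSum_matrixFamily_le {β r : ℝ} (hβ : 0 ≤ β) (hr0 : 0 ≤ r) (hr1 : r ≤ 1)
    (hε : 0 < ε) (hd : ∀ p i, 0 ≤ d p i) (hd1 : ∀ p i, d p i ≤ 1)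
    {X : P → Fin n → ℝ} (hX : ∀ p, X p ⬝ᵥ X p = 1) :
    ∫ z, partitionSum β (gordonPotential κ ε d) (evalAt (matrixFamily m X) z) ^ r
        ∂stdGaussian (GordonIndex m n) ≤
      ∫ z, partitionSum β (gordonPotential κ ε d) (evalAt (vectorFamily m X) z) ^ r
        ∂stdGaussian (GordonIndex m n) := by
  refine integral_partitionSum_rpow_le hβ (K := 1 + ε + m * |κ|) (by positivity) hr0 hr1
    (hasFDerivAt_gordonPotential hε hd) (continuous_gordonGradient hε hd)
    (abs_gordonGradient_le hε hd hd1) (abs_gordonPotential_le hε.le hd1)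
    (matrixFamily_dotProduct_vectorFamily X) (fun p j k => ?_) fun p q y y' => ?_
  · rw [matrixFamily_dotProduct, vectorFamily_dotProduct]
    rcases j with i | _ <;> rcases k with i' | _ <;> simp [hX]
  · have hXX : X p ⬝ᵥ X q ≤ 1 := by
      refine (Real.sum_mul_le_sqrt_mul_sqrt _ _ _).trans ?_
      have h := fun p => (Real.sqrt_eq_one (x := ∑ i, X p i ^ 2)).2 (by
        rw [← hX p, dotProduct]; exact Finset.sum_congr rfl fun i _ => sq _)
      rw [h, h, one_mul]
    have hD := sum_gordonGradient_mul_le (κ := κ) hε hd hd1 p q y y'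
    -- the double sum factors as `(1 - ⟨X p, X q⟩) (1 - ⟨∇, ∇'⟩)`
    have key : ∑ j, ∑ k, gordonGradient κ ε d p y j * gordonGradient κ ε d q y' k *
        (matrixFamily m X p j ⬝ᵥ matrixFamily m X q k -
          vectorFamily m X p j ⬝ᵥ vectorFamily m X q k) =
        (1 - X p ⬝ᵥ X q) * (1 - ∑ i, gordonGradient κ ε d p y (.inl i) *
          gordonGradient κ ε d q y' (.inl i)) := by
      simp only [matrixFamily_dotProduct, vectorFamily_dotProduct, Fintype.sum_sum_type,
        sub_self, mul_zero, Finset.sum_const_zero, add_zero, zero_add, Finset.univ_unique,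
        Finset.sum_singleton]
      have h1 : ∀ i, ∑ k, gordonGradient κ ε d p y (.inl i) * gordonGradient κ ε d q y' (.inl k) *
          ((if i = k then X p ⬝ᵥ X q else 0) - if i = k then 1 else 0) =
          (X p ⬝ᵥ X q - 1) *
            (gordonGradient κ ε d p y (.inl i) * gordonGradient κ ε d q y' (.inl i)) := by
        intro i
        rw [Finset.sum_eq_single i (fun b _ hb => by simp [hb.symm]) (by simp)]
        simp; ring
      simp only [h1, ← Finset.mul_sum]
      simp only [gordonGradient]
      ring
    rw [key]
    exact mul_nonneg (by linarith) (by linarith)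

/-- The comparison with a fixed inverse temperature `β` of the soft minimum and a fixed smoothing `ε`:
the factors `|P| ^ (c / β)` and `e ^ (c ε)` are the price of the approximation. -/
lemma measureReal_exists_residual_lt_le_aux {β c t : ℝ} (hc : 0 < c) (hβ : c ≤ β) (hε : 0 < ε)
    (hd : ∀ p i, 0 ≤ d p i) (hd1 : ∀ p i, d p i ≤ 1)
    {X : P → Fin n → ℝ} (hX : ∀ p, X p ⬝ᵥ X p = 1) {Ψ : (Fin m → ℝ) → ℝ} (hΨc : Continuous Ψ)
    (hΨ0 : ∀ y, 0 ≤ Ψ y) (hΨ : ∀ p y, Ψ y ≤ residual κ 0 (d p) y) :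
    (gaussianMatrix m n).real {H | ∃ p, residual κ 0 (d p) (fun i => H i ⬝ᵥ X p) < t} *
        (Real.exp (-c * (t + ε)) * Real.exp (c ^ 2 / 2)) ≤
      (Fintype.card P : ℝ) ^ (c / β) * ((∫ y, Real.exp (-c * Ψ y) ∂stdGaussian (Fin m)) *
        ∫ h, Real.exp (c * √(h ⬝ᵥ h)) ∂stdGaussian (Fin n)) := by
  have hβ0 : 0 < β := hc.trans_le hβ
  have hr0 : 0 ≤ c / β := by positivity
  have hr1 : c / β ≤ 1 := (div_le_one hβ0).2 hβ
  set S : Set (Fin m → Fin n → ℝ) := {H | ∃ p, residual κ 0 (d p) (fun i => H i ⬝ᵥ X p) < t}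
  set S' : Set (Fin m × Fin n → ℝ) := MeasurableEquiv.curry (Fin m) (Fin n) ℝ ⁻¹' S
  have hS : MeasurableSet S := by
    refine IsOpen.measurableSet ?_
    have : S = ⋃ p, {H | residual κ 0 (d p) (fun i => H i ⬝ᵥ X p) < t} := by
      ext H; simp [S]
    rw [this]
    refine isOpen_iUnion fun p => isOpen_lt (continuous_residual.comp ?_) continuous_const
    unfold dotProduct
    fun_prop
  have hS' : MeasurableSet S' := (MeasurableEquiv.measurable _) hS
  have hγ : (stdGaussian (Fin m × Fin n)).real S' = (gaussianMatrix m n).real S := by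
    rw [measureReal_def, measureReal_def,
      (measurePreserving_stdGaussian_curry m n).measure_preimage hS.nullMeasurableSet]
  -- the lower bound for the process of the matrix, where some residual is less than `t`
  have hlow : (gaussianMatrix m n).real S * (Real.exp (-c * (t + ε)) * Real.exp (c ^ 2 / 2)) ≤
      ∫ z, partitionSum β (gordonPotential κ ε d) (evalAt (matrixFamily m X) z) ^ (c / β)
        ∂stdGaussian (GordonIndex m n) := by
    have h1 := integral_stdGaussian_sum_mul (α' := Fin m × Fin n) (β' := Fin m ⊕ (Fin n ⊕ Unit))
      (S'.indicator fun _ => Real.exp (-c * (t + ε))) fun z => Real.exp (-c * z (.inr (.inr ())))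
    rw [integral_indicator_const _ hS', integral_exp_scalar, hγ, smul_eq_mul, neg_sq, mul_assoc]
      at h1
    rw [← h1]
    refine integral_mono_of_nonneg (ae_of_all _ fun z =>
      mul_nonneg (Set.indicator_nonneg (fun _ _ => (Real.exp_pos _).le) _) (Real.exp_pos _).le)
      (integrable_partitionSum_rpow hβ0.le (K := 1 + ε + m * |κ|) (by positivity) hr0 hr1
        (fun p => continuous_iff_continuousAt.2 fun y =>
          (hasFDerivAt_gordonPotential hε hd p y).continuousAt)
        (abs_gordonPotential_le hε.le hd1) _) (ae_of_all _ fun z => ?_)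
    by_cases hz : (fun a => z (.inl a)) ∈ S'
    · have hz' : ∃ p, residual κ 0 (d p)
        (fun i => (fun b => z (.inl (i, b))) ⬝ᵥ X p) < t := hz
      obtain ⟨p, hp⟩ := hz'
      simp only [Set.indicator_of_mem hz]
      rw [← Real.exp_add]
      have h2 := exp_le_partitionSum (β := β) (Φ := gordonPotential κ ε d)
        (evalAt (matrixFamily m X) z) p
      refine le_trans ?_ (Real.rpow_le_rpow (Real.exp_pos _).le h2 hr0)
      rw [← Real.exp_mul, Real.exp_le_exp, evalAt_matrixFamily, gordonPotential]
      simp only [Sum.elim_inl, Sum.elim_inr]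
      have h3 := (residual_le_add hε.le (hd p)
        (fun i => (fun b => z (.inl (i, b))) ⬝ᵥ X p)).trans (add_le_add_right hp.le ε)
      rw [show ∀ x : ℝ, -β * x * (c / β) = -(c * x) by intro x; field_simp]
      nlinarith
    · simp only [Set.indicator_of_notMem hz, zero_mul]
      exact Real.rpow_nonneg (partitionSum_pos _).le _
  have hup : ∫ z, partitionSum β (gordonPotential κ ε d) (evalAt (vectorFamily m X) z) ^ (c / β)
        ∂stdGaussian (GordonIndex m n) ≤
      (Fintype.card P : ℝ) ^ (c / β) * ((∫ y, Real.exp (-c * Ψ y) ∂stdGaussian (Fin m)) *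
        ∫ h, Real.exp (c * √(h ⬝ᵥ h)) ∂stdGaussian (Fin n)) := by
    have h1 := integral_stdGaussian_sum_mul (α' := Fin n) (β' := Unit)
      (fun h => Real.exp (c * √(h ⬝ᵥ h))) fun _ => 1
    have h2 := integral_stdGaussian_sum_mul (α' := Fin m) (β' := Fin n ⊕ Unit)
      (fun y => Real.exp (-c * Ψ y)) fun z =>
        Real.exp (c * √((fun b => z (.inl b)) ⬝ᵥ fun b => z (.inl b))) * 1
    have h3 := integral_stdGaussian_sum_mul (α' := Fin m × Fin n) (β' := Fin m ⊕ (Fin n ⊕ Unit))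
      (fun _ => (Fintype.card P : ℝ) ^ (c / β)) fun z =>
        Real.exp (-c * Ψ fun i => z (.inl i)) *
          (Real.exp (c * √((fun b => z (.inr (.inl b))) ⬝ᵥ fun b => z (.inr (.inl b)))) * 1)
    have hΨi : Integrable (fun y => Real.exp (-c * Ψ y)) (stdGaussian (Fin m)) := by
      refine Integrable.mono' (integrable_const 1)
        (Continuous.aestronglyMeasurable (by fun_prop)) (ae_of_all _ fun y => ?_)
      rw [Real.norm_eq_abs, Real.abs_exp, Real.exp_le_one_iff]
      nlinarith [hΨ0 y]
    have hi : Integrable (fun z : GordonIndex m n → ℝ => (Fintype.card P : ℝ) ^ (c / β) *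
        (Real.exp (-c * Ψ fun i => z (.inr (.inl i))) *
          (Real.exp (c * √((fun b => z (.inr (.inr (.inl b)))) ⬝ᵥ
            fun b => z (.inr (.inr (.inl b))))) * 1))) (stdGaussian (GordonIndex m n)) :=
      integrable_stdGaussian_sum_mul (integrable_const _)
        (integrable_stdGaussian_sum_mul hΨi
          (integrable_stdGaussian_sum_mul (integrable_exp_norm c hc.le) (integrable_const 1)))
    simp only [integral_const, probReal_univ, one_smul, mul_one] at h1 h2 h3 hi
    rw [← h1, ← h2, ← h3]
    refine integral_mono_of_nonneg
      (ae_of_all _ fun z => Real.rpow_nonneg (partitionSum_pos _).le _) hi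
      (ae_of_all _ fun z => ?_)
    set y : Fin m → ℝ := fun i => z (.inr (.inl i))
    set h : Fin n → ℝ := fun b => z (.inr (.inr (.inl b)))
    have hp : ∀ p, Real.exp (-β * gordonPotential κ ε d p (evalAt (vectorFamily m X) z p)) ≤
        Real.exp (-β * (Ψ y - √(h ⬝ᵥ h))) := by
      intro p
      refine Real.exp_le_exp.2 (mul_le_mul_of_nonpos_left ?_ (by linarith))
      rw [evalAt_vectorFamily, gordonPotential]
      simp only [Sum.elim_inl, Sum.elim_inr]
      have h4 : -(X p ⬝ᵥ h) ≤ √(h ⬝ᵥ h) := by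
        refine (neg_le_abs _).trans (Real.abs_le_sqrt ?_)
        have := Finset.sum_mul_sq_le_sq_mul_sq Finset.univ (X p) h
        simp only [sq (_ : ℝ)] at this ⊢
        calc _ ≤ _ := this
          _ = (X p ⬝ᵥ X p) * (h ⬝ᵥ h) := rfl
          _ = h ⬝ᵥ h := by rw [hX, one_mul]
      have h5 := (hΨ p y).trans (residual_zero_le (ε := ε) y)
      linarith
    have h6 : partitionSum β (gordonPotential κ ε d) (evalAt (vectorFamily m X) z) ≤
        Fintype.card P * Real.exp (-β * (Ψ y - √(h ⬝ᵥ h))) :=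
      (Finset.sum_le_card_nsmul _ _ _ fun p _ => hp p).trans (by simp)
    refine (Real.rpow_le_rpow (partitionSum_pos _).le h6 hr0).trans (le_of_eq ?_)
    change _ = (Fintype.card P : ℝ) ^ (c / β) *
      (Real.exp (-c * Ψ y) * Real.exp (c * √(h ⬝ᵥ h)))
    rw [Real.mul_rpow (Nat.cast_nonneg _) (Real.exp_pos _).le, ← Real.exp_mul, ← Real.exp_add]
    congr 2
    field_simp
    ring
  exact hlow.trans ((integral_partitionSum_matrixFamily_le hβ0.le hr0 hr1 hε hd hd1 hX).trans hup)

/-- **Gordon's bound** for finitely many directions and selections. -/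
lemma measureReal_exists_residual_lt_le_finite {c t : ℝ} (hc : 0 < c)
    (hd : ∀ p i, 0 ≤ d p i) (hd1 : ∀ p i, d p i ≤ 1)
    {X : P → Fin n → ℝ} (hX : ∀ p, X p ⬝ᵥ X p = 1) {Ψ : (Fin m → ℝ) → ℝ} (hΨc : Continuous Ψ)
    (hΨ0 : ∀ y, 0 ≤ Ψ y) (hΨ : ∀ p y, Ψ y ≤ residual κ 0 (d p) y) :
    (gaussianMatrix m n).real {H | ∃ p, residual κ 0 (d p) (fun i => H i ⬝ᵥ X p) < t} ≤
      Real.exp (c * t - c ^ 2 / 2) * ((∫ y, Real.exp (-c * Ψ y) ∂stdGaussian (Fin m)) *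
        ∫ h, Real.exp (c * √(h ⬝ᵥ h)) ∂stdGaussian (Fin n)) := by
  set I := (∫ y, Real.exp (-c * Ψ y) ∂stdGaussian (Fin m)) *
        ∫ h, Real.exp (c * √(h ⬝ᵥ h)) ∂stdGaussian (Fin n)
  set p := (gaussianMatrix m n).real {H | ∃ p, residual κ 0 (d p) (fun i => H i ⬝ᵥ X p) < t}
  have hlim1 : Tendsto (fun β : ℝ => p * (Real.exp (-c * (t + 1 / β)) * Real.exp (c ^ 2 / 2))) atTop
      (𝓝 (p * (Real.exp (-c * (t + 0)) * Real.exp (c ^ 2 / 2)))) := by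
    have h : Tendsto (fun β : ℝ => 1 / β) atTop (𝓝 0) := by
      simpa using tendsto_inv_atTop_zero (𝕜 := ℝ)
    exact ((((Real.continuous_exp.tendsto _).comp ((h.const_add t).const_mul (-c)))).mul_const
      _).const_mul _
  have hlim2 : Tendsto (fun β : ℝ => (Fintype.card P : ℝ) ^ (c / β) * I) atTop (𝓝 (1 * I)) := by
    have h : Tendsto (fun β : ℝ => c / β) atTop (𝓝 0) :=
      tendsto_const_nhds.div_atTop tendsto_id
    have h2 := (Real.continuousAt_const_rpow (a := (Fintype.card P : ℝ)) (b := 0)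
      (Nat.cast_ne_zero.2 Fintype.card_ne_zero)).tendsto.comp h
    rw [Real.rpow_zero] at h2
    exact h2.mul_const I
  have h := le_of_tendsto_of_tendsto hlim1 hlim2 (by
    filter_upwards [eventually_ge_atTop c, eventually_gt_atTop 0] with β hβ hβ0
    exact measureReal_exists_residual_lt_le_aux hc hβ (one_div_pos.2 hβ0) hd hd1 hX hΨc hΨ0 hΨ)
  rw [add_zero, one_mul, ← Real.exp_add] at h
  rw [show c * t - c ^ 2 / 2 = -(-c * t + c ^ 2 / 2) by ring, Real.exp_neg, inv_mul_eq_div,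
    le_div_iff₀ (Real.exp_pos _)]
  exact h

end Gordon

/-! ### Gordon's bound on the sphere -/

/-- For some unit vector `x` and some selection of `k` rows, the violations of the constraints
`κ ≤ (H x)_i` of these rows have Euclidean norm less than `t`. -/
def NearlyFeasible {m n : ℕ} (κ : ℝ) (k : ℕ) (t : ℝ) (H : Matrix (Fin m) (Fin n) ℝ) : Prop :=
  ∃ x : EuclideanSpace ℝ (Fin n), ‖x‖ = 1 ∧ ∃ d ∈ selectionVectors m k,
    residual κ 0 d (H.mulVec x.ofLp) < t

lemma nonneg_of_mem_selectionVectors {m k : ℕ} {d : Fin m → ℝ} (hd : d ∈ selectionVectors m k)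
    (i : Fin m) : 0 ≤ d i := by
  rcases hd.1 i with h | h <;> simp [h]

lemma le_one_of_mem_selectionVectors {m k : ℕ} {d : Fin m → ℝ} (hd : d ∈ selectionVectors m k)
    (i : Fin m) : d i ≤ 1 := by
  rcases hd.1 i with h | h <;> simp [h]

lemma finite_selectionVectors (m k : ℕ) : (selectionVectors m k).Finite := by
  refine (Set.Finite.pi (t := fun _ : Fin m => ({0, 1} : Set ℝ)) fun _ => by simp).subset ?_
  intro d hd i _
  simpa using hd.1 i

/-- **Gordon's bound** on the whole sphere, from a dense sequence of directions. -/
lemma measureReal_nearlyFeasible_le {m n k : ℕ} {κ c t : ℝ} (hc : 0 < c) {Ψ : (Fin m → ℝ) → ℝ}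
    (hΨc : Continuous Ψ) (hΨ0 : ∀ y, 0 ≤ Ψ y)
    (hΨ : ∀ d ∈ selectionVectors m k, ∀ y, Ψ y ≤ residual κ 0 d y) :
    (gaussianMatrix m n).real {H | NearlyFeasible κ k t (Matrix.of H)} ≤
      Real.exp (c * t - c ^ 2 / 2) * ((∫ y, Real.exp (-c * Ψ y) ∂stdGaussian (Fin m)) *
        ∫ h, Real.exp (c * √(h ⬝ᵥ h)) ∂stdGaussian (Fin n)) := by
  set R := Real.exp (c * t - c ^ 2 / 2) * ((∫ y, Real.exp (-c * Ψ y) ∂stdGaussian (Fin m)) *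
        ∫ h, Real.exp (c * √(h ⬝ᵥ h)) ∂stdGaussian (Fin n))
  have hR : 0 ≤ R := mul_nonneg (Real.exp_pos _).le (mul_nonneg
    (integral_nonneg fun _ => (Real.exp_pos _).le) (integral_nonneg fun _ => (Real.exp_pos _).le))
  rcases Set.eq_empty_or_nonempty {H | NearlyFeasible (m := m) (n := n) κ k t (Matrix.of H)}
    with h | ⟨H₀, x₀, hx₀, d₀, hd₀, -⟩
  · rw [h]; simpa using hR
  have : Nonempty (Metric.sphere (0 : EuclideanSpace ℝ (Fin n)) 1) := ⟨⟨x₀, by simpa using hx₀⟩⟩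
  have : Nonempty (selectionVectors m k) := ⟨⟨d₀, hd₀⟩⟩
  have : Fintype (selectionVectors m k) := (finite_selectionVectors m k).fintype
  set x : ℕ → Metric.sphere (0 : EuclideanSpace ℝ (Fin n)) 1 := TopologicalSpace.denseSeq _
  set E : ℕ → Set (Fin m → Fin n → ℝ) := fun N => {H | ∃ p : Fin (N + 1) × selectionVectors m k,
    residual κ 0 p.2 (fun i => H i ⬝ᵥ (x p.1).1.ofLp) < t}
  have hE : Monotone E := by
    rintro N M hNM H ⟨⟨i, d⟩, h⟩
    exact ⟨⟨⟨i, by omega⟩, d⟩, h⟩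
  have hsub : {H | NearlyFeasible (m := m) (n := n) κ k t (Matrix.of H)} ⊆ ⋃ N, E N := by
    rintro H ⟨y, hy, d, hd, h⟩
    have ho : IsOpen {z : Metric.sphere (0 : EuclideanSpace ℝ (Fin n)) 1 |
        residual κ 0 d (fun i => H i ⬝ᵥ z.1.ofLp) < t} := by
      refine isOpen_lt (continuous_residual.comp ?_) continuous_const
      unfold dotProduct
      fun_prop
    obtain ⟨i, hi⟩ := (TopologicalSpace.denseRange_denseSeq
      (Metric.sphere (0 : EuclideanSpace ℝ (Fin n)) 1)).exists_mem_open ho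
      ⟨⟨y, by simpa using hy⟩, h⟩
    exact Set.mem_iUnion.2 ⟨i, ⟨⟨i, by omega⟩, ⟨d, hd⟩⟩, hi⟩
  have hfin : ∀ N, gaussianMatrix m n (E N) ≤ ENNReal.ofReal R := by
    intro N
    have hx1 : ∀ i, (x i).1.ofLp ⬝ᵥ (x i).1.ofLp = 1 := fun i => by
      have h := (x i).2
      rw [mem_sphere_zero_iff_norm] at h
      have h2 := EuclideanSpace.real_norm_sq_eq (x i).1
      rw [h] at h2
      simpa [dotProduct, sq] using h2.symm
    have h := measureReal_exists_residual_lt_le_finite (m := m) (n := n) (κ := κ) (t := t)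
      (P := Fin (N + 1) × selectionVectors m k) (d := fun p => p.2) hc
      (fun p => nonneg_of_mem_selectionVectors p.2.2)
      (fun p => le_one_of_mem_selectionVectors p.2.2)
      (X := fun p => (x p.1).1.ofLp) (fun p => hx1 _) hΨc hΨ0 (fun p => hΨ _ p.2.2)
    have : IsProbabilityMeasure (gaussianMatrix m n) := by unfold gaussianMatrix; infer_instance
    exact (ENNReal.le_ofReal_iff_toReal_le (measure_ne_top _ _) hR).2 h
  refine ENNReal.toReal_le_of_le_ofReal hR ((measure_mono hsub).trans ?_)
  rw [hE.measure_iUnion]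
  exact iSup_le hfin

/-! ### The Gaussian vectors of the bound -/

lemma integral_exp_sq_gaussianReal {c : ℝ} (hc : c < 1) :
    ∫ x, Real.exp (c / 2 * x ^ 2) ∂gaussianReal 0 1 = √(1 - c)⁻¹ := by
  rw [integral_gaussianReal_eq_integral_smul one_ne_zero]
  have h : ∀ x : ℝ, gaussianPDFReal 0 1 x • Real.exp (c / 2 * x ^ 2) =
      (√(2 * Real.pi))⁻¹ * Real.exp (-((1 - c) / 2) * x ^ 2) := by
    intro x
    rw [gaussianPDFReal]
    simp only [NNReal.coe_one, mul_one, sub_zero, smul_eq_mul, mul_assoc, ← Real.exp_add]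
    congr 2
    ring
  simp_rw [h]
  rw [integral_const_mul, integral_gaussian, ← Real.sqrt_inv, ← Real.sqrt_mul (by positivity)]
  congr 1
  have : 1 - c ≠ 0 := by linarith
  field_simp

/-- The exponential moment of the norm of a Gaussian vector, at the scale `√n`. -/
lemma integral_exp_norm_stdGaussian_le {c : ℝ} (hc0 : 0 < c) (hc : c ≤ 1 / 2) (n : ℕ) :
    ∫ h, Real.exp (c * √n * √(h ⬝ᵥ h)) ∂stdGaussian (Fin n) ≤ Real.exp (n * (c + c ^ 2)) := by
  have hc1 : 0 < 1 - c := by linarith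
  have hint : Integrable (fun x : ℝ => Real.exp (c / 2 * x ^ 2)) (gaussianReal 0 1) := by
    by_contra hni
    have h := integral_exp_sq_gaussianReal (c := c) (by linarith)
    rw [integral_undef hni] at h
    exact (Real.sqrt_pos.2 (inv_pos.2 hc1)).ne h
  have hle : ∀ h : Fin n → ℝ, Real.exp (c * √n * √(h ⬝ᵥ h)) ≤
      Real.exp (c / 2 * n) * ∏ i, Real.exp (c / 2 * h i ^ 2) := by
    intro h
    have hh : 0 ≤ h ⬝ᵥ h := Finset.sum_nonneg fun i _ => mul_self_nonneg _
    rw [← Real.exp_sum, ← Real.exp_add, ← Finset.mul_sum, Real.exp_le_exp]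
    have h1 : ∑ i, h i ^ 2 = h ⬝ᵥ h := by simp [dotProduct, sq]
    rw [h1]
    nlinarith [sq_nonneg (√(n : ℝ) - √(h ⬝ᵥ h)), Real.sq_sqrt hh,
      Real.sq_sqrt (Nat.cast_nonneg (α := ℝ) n)]
  have hpi : Integrable (fun h : Fin n → ℝ => Real.exp (c / 2 * n) *
      ∏ i, Real.exp (c / 2 * h i ^ 2)) (stdGaussian (Fin n)) :=
    (Integrable.fintype_prod (f := fun _ x => Real.exp (c / 2 * x ^ 2)) fun _ => hint).const_mul _
  refine (integral_mono_of_nonneg (ae_of_all _ fun h => (Real.exp_pos _).le) hpi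
    (ae_of_all _ hle)).trans ?_
  rw [integral_const_mul, stdGaussian,
    integral_fintype_prod_eq_pow (ι := Fin n) fun x : ℝ => Real.exp (c / 2 * x ^ 2),
    integral_exp_sq_gaussianReal (by linarith), Fintype.card_fin]
  have hsq : √(1 - c)⁻¹ ≤ Real.exp (c / 2 + c ^ 2) := by
    refine Real.sqrt_le_iff.2 ⟨(Real.exp_pos _).le, ?_⟩
    rw [← Real.exp_nat_mul, inv_le_comm₀ hc1 (Real.exp_pos _), ← Real.exp_neg,
      ← Real.le_log_iff_exp_le hc1]
    have h := Real.one_sub_inv_le_log_of_pos hc1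
    refine le_trans ?_ h
    have h2 : (1 - c)⁻¹ ≤ 1 + c + 2 * c ^ 2 := by
      rw [inv_le_iff_one_le_mul₀ hc1]
      nlinarith [mul_nonneg (sq_nonneg c) (by linarith : 0 ≤ 1 - 2 * c)]
    push_cast
    linarith
  calc Real.exp (c / 2 * n) * √(1 - c)⁻¹ ^ n
      ≤ Real.exp (c / 2 * n) * Real.exp (c / 2 + c ^ 2) ^ n := by gcongr
    _ = Real.exp (n * (c + c ^ 2)) := by
        rw [← Real.exp_nat_mul, ← Real.exp_add]; congr 1; ring

/-- The squared violation `(κ - g)₊²` truncated at the level `τ`. -/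
noncomputable def truncatedViolation (κ τ g : ℝ) : ℝ := min (max (κ - g) 0 ^ 2) τ

/-- A lower bound, valid for every `τ`, for the norm of the `k` smallest violations: the sum of the
`k` smallest among `m` numbers is at least the sum of their truncations at `τ` minus `(m - k) τ`. -/
noncomputable def residualBound (κ τ : ℝ) {m : ℕ} (k : ℕ) (y : Fin m → ℝ) : ℝ :=
  √(∑ i, truncatedViolation κ τ (y i) - (m - k) * τ)

lemma continuous_truncatedViolation (κ τ : ℝ) : Continuous (truncatedViolation κ τ) := by
  unfold truncatedViolation; fun_prop

lemma continuous_residualBound (κ τ : ℝ) {m : ℕ} (k : ℕ) :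
    Continuous (residualBound κ τ (m := m) k) := by
  have := continuous_truncatedViolation κ τ
  unfold residualBound
  fun_prop

lemma residualBound_le_residual {κ τ : ℝ} {m k : ℕ} {d : Fin m → ℝ}
    (hd : d ∈ selectionVectors m k) (y : Fin m → ℝ) :
    residualBound κ τ k y ≤ residual κ 0 d y := by
  refine Real.sqrt_le_sqrt ?_
  have h : ∑ i, truncatedViolation κ τ (y i) ≤
      ∑ i, (d i * max (κ - y i) 0 ^ 2 + (1 - d i) * τ) := by
    refine Finset.sum_le_sum fun i _ => ?_
    rcases hd.1 i with h | h <;> simp [h, truncatedViolation]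
  rw [Finset.sum_add_distrib, ← Finset.sum_mul, Finset.sum_sub_distrib, hd.2] at h
  simp at h
  linarith

lemma truncatedViolation_mem_Icc {κ τ : ℝ} (hτ : 0 ≤ τ) (g : ℝ) :
    truncatedViolation κ τ g ∈ Set.Icc 0 (τ + 1) :=
  ⟨le_min (sq_nonneg _) hτ, (min_le_right _ _).trans (by linarith)⟩

lemma measureReal_sum_truncatedViolation_le {κ τ s : ℝ} (hτ : 0 ≤ τ) (hs : 0 ≤ s) (m : ℕ) :
    (stdGaussian (Fin m)).real {y | ∑ i, truncatedViolation κ τ (y i) ≤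
      m * (∫ g, truncatedViolation κ τ g ∂gaussianReal 0 1) - m * s} ≤
      Real.exp (-(2 * s ^ 2 / (τ + 1) ^ 2) * m) := by
  set μ := ∫ g, truncatedViolation κ τ g ∂gaussianReal 0 1
  have hmeas := (continuous_truncatedViolation κ τ).measurable
  have h1 : HasSubgaussianMGF (fun g => truncatedViolation κ τ g - μ)
      ((‖τ + 1 - 0‖₊ / 2) ^ 2) (gaussianReal 0 1) :=
    hasSubgaussianMGF_of_mem_Icc hmeas.aemeasurable
      (ae_of_all _ fun g => truncatedViolation_mem_Icc hτ g)
  have h2 : ∀ i : Fin m, HasSubgaussianMGF (fun y : Fin m → ℝ =>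
      -(truncatedViolation κ τ (y i) - μ)) ((‖τ + 1 - 0‖₊ / 2) ^ 2) (stdGaussian (Fin m)) := by
    intro i
    have hmp : MeasurePreserving (Function.eval i) (stdGaussian (Fin m)) (gaussianReal 0 1) :=
      measurePreserving_eval (fun _ : Fin m => gaussianReal 0 1) i
    refine HasSubgaussianMGF.of_map (X := fun g => -(truncatedViolation κ τ g - μ))
      (Y := Function.eval i) hmp.measurable.aemeasurable ?_
    rw [hmp.map_eq]
    exact h1.neg
  have hind : iIndepFun (fun (i : Fin m) (y : Fin m → ℝ) => -(truncatedViolation κ τ (y i) - μ))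
      (stdGaussian (Fin m)) :=
    iIndepFun_pi (X := fun _ g => -(truncatedViolation κ τ g - μ))
      fun i => ((hmeas.sub_const μ).neg).aemeasurable
  have h3 := HasSubgaussianMGF.measure_sum_ge_le_of_iIndepFun hind (s := Finset.univ)
    (fun i _ => h2 i) (ε := m * s) (by positivity)
  refine le_trans (measureReal_mono ?_) (h3.trans (Real.exp_le_exp.2 (le_of_eq ?_)))
  · intro y hy
    simp only [Set.mem_ofPred_eq, Finset.sum_neg_distrib, Finset.sum_sub_distrib, Finset.sum_const,
      Finset.card_univ, Fintype.card_fin, nsmul_eq_mul] at hy ⊢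
    linarith
  · have h4 : |τ + 1| = τ + 1 := abs_of_nonneg (by linarith)
    have h5 : τ + 1 ≠ 0 := by linarith
    simp [h4]
    rcases Nat.eq_zero_or_pos m with rfl | hm
    · simp
    · field_simp

/-! ### Exponentially small probabilities -/

section Asymptotics

variable {κ τ f F α : ℝ} {m k : ℕ → ℕ}

lemma integral_exp_residualBound_le {m k : ℕ} {c b : ℝ} (hc : 0 ≤ c) :
    ∫ y, Real.exp (-c * residualBound κ τ k y) ∂stdGaussian (Fin m) ≤
      Real.exp (-c * b) + (stdGaussian (Fin m)).real {y | residualBound κ τ k y < b} := by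
  have hms : MeasurableSet {y : Fin m → ℝ | residualBound κ τ k y < b} :=
    (isOpen_lt (continuous_residualBound κ τ k) continuous_const).measurableSet
  have h : ∫ y : Fin m → ℝ, (Real.exp (-c * b) +
      {y : Fin m → ℝ | residualBound κ τ k y < b}.indicator (fun _ => (1 : ℝ)) y)
        ∂stdGaussian (Fin m) =
      Real.exp (-c * b) + (stdGaussian (Fin m)).real {y | residualBound κ τ k y < b} := by
    rw [integral_add (integrable_const _) ((integrable_const _).indicator hms),
      integral_indicator_const _ hms]
    simp
  rw [← h]
  refine integral_mono_of_nonneg (ae_of_all _ fun y => (Real.exp_pos _).le)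
    ((integrable_const _).add ((integrable_const _).indicator hms)) (ae_of_all _ fun y => ?_)
  have h0 : 0 ≤ residualBound κ τ k y := Real.sqrt_nonneg _
  dsimp only
  by_cases hy : residualBound κ τ k y < b
  · rw [Set.indicator_of_mem (by exact hy)]
    have : Real.exp (-c * residualBound κ τ k y) ≤ 1 := Real.exp_le_one_iff.2 (by nlinarith)
    linarith [Real.exp_pos (-c * b)]
  · rw [Set.indicator_of_notMem (by exact hy), add_zero, Real.exp_le_exp]
    nlinarith [not_lt.1 hy]

/-- The residual of a Gaussian vector is at least `√(α F n)` up to a small relative error, except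
with exponentially small probability. -/
lemma exists_eventually_integral_exp_residualBound_le (hτ : 0 ≤ τ) (hα : 0 < α)
    (hmean : ∫ g, truncatedViolation κ τ g ∂gaussianReal 0 1 = F + f * τ)
    (hm : Tendsto (fun n : ℕ => (m n : ℝ) / n) atTop (𝓝 α))
    (hk : Tendsto (fun n : ℕ => (k n : ℝ) / m n) atTop (𝓝 (1 - f)))
    {B : ℝ} (hB : B < √(α * F)) :
    ∃ s : ℝ, 0 < s ∧ ∀ᶠ n : ℕ in atTop, ∀ c : ℝ, 0 ≤ c →
      ∫ y, Real.exp (-c * residualBound κ τ (k n) y) ∂stdGaussian (Fin (m n)) ≤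
        Real.exp (-c * (B * √n)) + Real.exp (-s * n) := by
  rcases le_or_gt B 0 with hB0 | hB0
  · refine ⟨1, one_pos, Eventually.of_forall fun n c hc => ?_⟩
    refine (integral_exp_residualBound_le (b := B * √n) hc).trans ?_
    have : {y : Fin (m n) → ℝ | residualBound κ τ (k n) y < B * √n} = ∅ := by
      ext y
      have h0 : 0 ≤ residualBound κ τ (k n) y := Real.sqrt_nonneg _
      have h1 : B * √n ≤ 0 := mul_nonpos_of_nonpos_of_nonneg hB0 (Real.sqrt_nonneg _)
      simp only [Set.mem_ofPred_eq, Set.mem_empty_iff_false, iff_false, not_lt]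
      linarith
    rw [this, measureReal_empty]
    gcongr
    exact (Real.exp_pos _).le
  have hBF : B ^ 2 < α * F := (Real.lt_sqrt hB0.le).1 hB
  set s : ℝ := (α * F - B ^ 2) / (2 * α)
  have hs : 0 < s := div_pos (by linarith) (by linarith)
  have hsα : s * α = (α * F - B ^ 2) / 2 := by simp only [s]; field_simp
  refine ⟨2 * s ^ 2 / (τ + 1) ^ 2 * (α / 2), by positivity, ?_⟩
  have hlim : Tendsto (fun n : ℕ => (m n : ℝ) / n * (F + f * τ - s) -
      ((m n : ℝ) / n) * (1 - (k n : ℝ) / m n) * τ) atTop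
      (𝓝 (α * (F + f * τ - s) - α * (1 - (1 - f)) * τ)) :=
    (hm.mul_const _).sub ((hm.mul (hk.const_sub 1)).mul_const τ)
  have hlt : B ^ 2 < α * (F + f * τ - s) - α * (1 - (1 - f)) * τ := by nlinarith
  filter_upwards [hlim.eventually_const_lt hlt, hm.eventually_const_lt (half_lt_self hα),
    eventually_gt_atTop 0] with n h1 h2 hn c hc
  have hn0 : (0 : ℝ) < n := Nat.cast_pos.2 hn
  have hm0 : (0 : ℝ) < m n := by
    have : (0 : ℝ) < m n / n := (half_pos hα).trans h2
    exact (div_pos_iff_of_pos_right hn0).1 this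
  rw [lt_div_iff₀ hn0] at h2
  refine (integral_exp_residualBound_le (b := B * √n) hc).trans ?_
  gcongr
  refine (measureReal_mono fun y hy => ?_).trans
    ((measureReal_sum_truncatedViolation_le hτ hs.le (m n)).trans (Real.exp_le_exp.2 ?_))
  · rw [Set.mem_ofPred_eq, residualBound, Real.sqrt_lt' (by positivity), mul_pow,
      Real.sq_sqrt hn0.le] at hy
    rw [Set.mem_ofPred_eq, hmean]
    have h3 : (B ^ 2) * n < (m n) * (F + f * τ - s) - (m n - k n) * τ := by
      have := mul_lt_mul_of_pos_right h1 hn0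
      refine this.trans_le (le_of_eq ?_)
      field_simp
    linarith
  · have : 0 ≤ 2 * s ^ 2 / (τ + 1) ^ 2 := by positivity
    nlinarith

/-- Below the level `√(α F) - 1` the perceptron is nearly feasible only with exponentially small
probability. -/
lemma exists_eventually_measureReal_nearlyFeasible_le (hτ : 0 ≤ τ) (hα : 0 < α)
    (hmean : ∫ g, truncatedViolation κ τ g ∂gaussianReal 0 1 = F + f * τ)
    (hm : Tendsto (fun n : ℕ => (m n : ℝ) / n) atTop (𝓝 α))
    (hk : Tendsto (fun n : ℕ => (k n : ℝ) / m n) atTop (𝓝 (1 - f)))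
    {C : ℝ} (hC : C < √(α * F) - 1) :
    ∃ c : ℝ, 0 < c ∧ ∀ᶠ n : ℕ in atTop,
      (gaussianMatrix (m n) n).real {H | NearlyFeasible κ (k n) (C * √n) (Matrix.of H)} ≤
        Real.exp (-c * n) := by
  set δ := √(α * F) - 1 - C
  have hδ : 0 < δ := by simp only [δ]; linarith
  obtain ⟨s, hs, hev⟩ := exists_eventually_integral_exp_residualBound_le hτ hα hmean hm hk
    (B := √(α * F) - δ / 2) (by linarith)
  -- the exponential moments are taken at `a √n`, with `a` small enough for both terms to decay
  obtain ⟨a, ha0, ha1, ha2, ha3⟩ : ∃ a : ℝ, 0 < a ∧ a ≤ 1 / 2 ∧ a ≤ δ / 2 ∧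
      a * (|C| + 2) ≤ s / 2 := by
    refine ⟨min (1 / 2) (min (δ / 2) (s / 2 / (|C| + 2))), by positivity, min_le_left _ _,
      (min_le_right _ _).trans (min_le_left _ _), ?_⟩
    rw [← le_div_iff₀ (by positivity)]
    exact (min_le_right _ _).trans (min_le_right _ _)
  set e := min (a * δ / 4) (s / 2)
  have he : 0 < e := by positivity
  refine ⟨e / 2, by positivity, ?_⟩
  have hlarge : ∀ᶠ n : ℕ in atTop, Real.log 2 ≤ e / 2 * n :=
    (tendsto_natCast_atTop_atTop.const_mul_atTop (by positivity : 0 < e / 2)).eventually_ge_atTop _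
  filter_upwards [hev, hlarge, eventually_gt_atTop 0] with n h1 h2 hn
  have hn0 : (0 : ℝ) < n := Nat.cast_pos.2 hn
  have hsq : √(n : ℝ) * √n = n := Real.mul_self_sqrt hn0.le
  refine (measureReal_nearlyFeasible_le (c := a * √n) (by positivity)
    (continuous_residualBound κ τ (k n)) (fun y => Real.sqrt_nonneg _)
    fun d hd y => residualBound_le_residual hd y).trans ?_
  have hI := h1 (a * √n) (by positivity)
  have hN := integral_exp_norm_stdGaussian_le ha0 ha1 n
  have hfirst : a * √n * (C * √n) - (a * √n) ^ 2 / 2 + n * (a + a ^ 2) =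
      n * (a * (C + 1) + a ^ 2 / 2) := by
    linear_combination (a * C - a ^ 2 / 2) * hsq
  calc Real.exp (a * √n * (C * √n) - (a * √n) ^ 2 / 2) *
        ((∫ y, Real.exp (-(a * √n) * residualBound κ τ (k n) y) ∂stdGaussian (Fin (m n))) *
          ∫ h, Real.exp (a * √n * √(h ⬝ᵥ h)) ∂stdGaussian (Fin n))
      ≤ Real.exp (a * √n * (C * √n) - (a * √n) ^ 2 / 2) *
        ((Real.exp (-(a * √n) * ((√(α * F) - δ / 2) * √n)) + Real.exp (-s * n)) *
          Real.exp (n * (a + a ^ 2))) := by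
        gcongr
    _ = Real.exp (n * (a * (C + 1) + a ^ 2 / 2)) *
        (Real.exp (-(a * √n) * ((√(α * F) - δ / 2) * √n)) + Real.exp (-s * n)) := by
        rw [← hfirst, Real.exp_add]; ring
    _ ≤ Real.exp (-e * n) + Real.exp (-e * n) := by
        rw [mul_add, ← Real.exp_add, ← Real.exp_add]
        gcongr
        · have h3 : -(a * √n) * ((√(α * F) - δ / 2) * √n) = -a * (√(α * F) - δ / 2) * n := by
            linear_combination (-a * (√(α * F) - δ / 2)) * hsq
          have h4 : √(α * F) = δ + 1 + C := by simp only [δ]; ring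
          rw [h3, h4]
          have h5 : e ≤ a * δ / 4 := min_le_left _ _
          have h6 : a * (C + 1) + a ^ 2 / 2 - a * (δ + 1 + C - δ / 2) ≤ -e := by nlinarith
          nlinarith
        · have h5 : e ≤ s / 2 := min_le_right _ _
          have h6 : a * (C + 1) + a ^ 2 / 2 - s ≤ -e := by
            nlinarith [le_abs_self C]
          nlinarith
    _ = Real.exp (Real.log 2 + -e * n) := by
        rw [Real.exp_add, Real.exp_log two_pos]; ring
    _ ≤ Real.exp (-(e / 2) * n) := Real.exp_le_exp.2 (by linarith)

end Asymptotics

/-! ### The error function and the threshold -/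

lemma integrable_exp_neg_sq : Integrable fun t : ℝ => Real.exp (-t ^ 2) := by
  simpa using integrable_exp_neg_mul_sq (b := 1) one_pos

lemma integral_Ioi_exp_neg_sq : ∫ t in Set.Ioi (0 : ℝ), Real.exp (-t ^ 2) = √Real.pi / 2 := by
  simpa using integral_gaussian_Ioi 1

lemma erf_neg (y : ℝ) : erf (-y) = -erf y := by
  have h := intervalIntegral.integral_comp_neg (a := 0) (b := y) fun t : ℝ => Real.exp (-t ^ 2)
  simp only [neg_sq, neg_zero] at h
  rw [erf, erf, h, intervalIntegral.integral_symm (-y) 0]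
  ring

lemma continuous_erf : Continuous erf := by
  unfold erf
  exact continuous_const.mul (intervalIntegral.continuous_primitive
    (fun a b => integrable_exp_neg_sq.intervalIntegrable) 0)

lemma tendsto_erf_atTop : Tendsto erf atTop (𝓝 1) := by
  have h := (intervalIntegral_tendsto_integral_Ioi 0 integrable_exp_neg_sq.integrableOn
    tendsto_id).const_mul (2 / √Real.pi)
  rw [integral_Ioi_exp_neg_sq] at h
  have h1 : 2 / √Real.pi * (√Real.pi / 2) = 1 := by
    have : √Real.pi ≠ 0 := (Real.sqrt_pos.2 Real.pi_pos).ne'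
    field_simp
  rw [h1] at h
  exact h

lemma erf_erfinv {s : ℝ} (h1 : -1 < s) (h2 : s < 1) : erf (erfinv s) = s := by
  refine Function.invFun_eq (mem_range_of_exists_le_of_exists_ge continuous_erf ?_ ?_)
  · obtain ⟨y, hy⟩ := (tendsto_erf_atTop.eventually_const_lt (neg_lt.1 h1)).exists
    exact ⟨-y, by rw [erf_neg]; linarith⟩
  · obtain ⟨y, hy⟩ := (tendsto_erf_atTop.eventually_const_lt h2).exists
    exact ⟨y, hy.le⟩

/-- The standard normal distribution function. -/
noncomputable def normalCDF (t : ℝ) : ℝ :=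
  1 / √(2 * Real.pi) * ∫ z in Set.Iic t, Real.exp (-z ^ 2 / 2)

lemma integrable_exp_neg_sq_div_two : Integrable fun z : ℝ => Real.exp (-z ^ 2 / 2) := by
  refine (integrable_exp_neg_mul_sq (b := 1 / 2) (by norm_num)).congr (ae_of_all _ fun z => ?_)
  simp only
  congr 1
  ring

lemma normalCDF_neg_sqrt_two_mul (y : ℝ) : normalCDF (-(√2 * y)) = (1 - erf y) / 2 := by
  have h2 : (0 : ℝ) < √2 := by positivity
  have h1 : ∫ z in Set.Iic (-(√2 * y)), Real.exp (-z ^ 2 / 2) =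
      √2 * ∫ t in Set.Ioi y, Real.exp (-t ^ 2) := by
    have h := integral_comp_mul_left_Ioi (fun z : ℝ => Real.exp (-z ^ 2 / 2)) y h2
    have h' := integral_comp_neg_Iic (-(√2 * y)) fun z : ℝ => Real.exp (-z ^ 2 / 2)
    simp only [neg_sq, neg_neg, mul_pow, Real.sq_sqrt zero_le_two] at h h'
    rw [h', smul_eq_mul, eq_inv_mul_iff_mul_eq₀ h2.ne'] at *
    rw [← h]
    congr 2
    funext t
    congr 1
    ring
  have h3 : ∫ t in Set.Ioi y, Real.exp (-t ^ 2) =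
      √Real.pi / 2 - ∫ t in (0 : ℝ)..y, Real.exp (-t ^ 2) := by
    have h := intervalIntegral.integral_interval_add_Ioi
      (integrable_exp_neg_sq.integrableOn (s := Set.Ioi 0))
      (integrable_exp_neg_sq.integrableOn (s := Set.Ioi y))
    rw [← integral_Ioi_exp_neg_sq, ← h]
    ring
  have hpi : √Real.pi ≠ 0 := (Real.sqrt_pos.2 Real.pi_pos).ne'
  rw [normalCDF, h1, h3, erf, Real.sqrt_mul zero_le_two]
  field_simp

lemma strictMono_normalCDF : StrictMono normalCDF := by
  intro a b hab
  have h := intervalIntegral.integral_Iic_sub_Iic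
    (integrable_exp_neg_sq_div_two.integrableOn (s := Set.Iic a))
    (integrable_exp_neg_sq_div_two.integrableOn (s := Set.Iic b))
  have hpos : 0 < ∫ z in a..b, Real.exp (-z ^ 2 / 2) :=
    intervalIntegral.intervalIntegral_pos_of_pos
      integrable_exp_neg_sq_div_two.intervalIntegrable (fun z => Real.exp_pos _) hab
  unfold normalCDF
  gcongr
  linarith

lemma normalCDF_eq_measureReal (t : ℝ) : normalCDF t = (gaussianReal 0 1).real (Set.Iic t) := by
  rw [measureReal_def, gaussianReal_apply_eq_integral 0 one_ne_zero, ENNReal.toReal_ofReal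
    (integral_nonneg fun x => gaussianPDFReal_nonneg 0 1 x), normalCDF, ← integral_const_mul]
  simp [gaussianPDFReal]

lemma normalCDF_neg_erfinv {f : ℝ} (hf0 : 0 < f) (hf1 : f < 1) :
    normalCDF (-(√2 * erfinv (1 - 2 * f))) = f := by
  rw [normalCDF_neg_sqrt_two_mul, erf_erfinv (by linarith) (by linarith)]
  ring

variable {κ f : ℝ}

lemma sqrt_nuHat (hκ : 0 ≤ √2 * erfinv (1 - 2 * f) + κ) :
    √(nuHat κ f) = √2 * erfinv (1 - 2 * f) + κ :=
  Real.sqrt_sq hκ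

lemma normalCDF_sub_sqrt_nuHat (hf0 : 0 < f) (hf1 : f < 1)
    (hκ : 0 ≤ √2 * erfinv (1 - 2 * f) + κ) : normalCDF (κ - √(nuHat κ f)) = f := by
  rw [sqrt_nuHat hκ]
  convert normalCDF_neg_erfinv hf0 hf1 using 2
  ring

lemma gardnerDerridaEquation_iff (hf0 : 0 < f) (hf1 : f < 1)
    (hκ : 0 ≤ √2 * erfinv (1 - 2 * f) + κ) (x : ℝ) :
    GardnerDerridaEquation κ f x ↔ x = √(nuHat κ f) := by
  have h := normalCDF_sub_sqrt_nuHat hf0 hf1 hκ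
  constructor
  · intro hx
    have h1 : normalCDF (κ - √(nuHat κ f)) = normalCDF (κ - x) := h.trans hx
    linarith [strictMono_normalCDF.injective h1]
  · rintro rfl
    exact h.symm

lemma gardnerDerrida_integral_eq (κ f : ℝ) :
    1 / √(2 * Real.pi) *
      ∫ z in (κ - √(nuHat κ f))..κ, (z - κ) ^ 2 * Real.exp (-z ^ 2 / 2) = fErrHat κ f := by
  have h := intervalIntegral.integral_comp_neg (a := κ - √(nuHat κ f)) (b := κ)
    fun g : ℝ => (g + κ) ^ 2 * Real.exp (-g ^ 2 / 2)
  rw [neg_sub] at h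
  rw [fErrHat, ← h]
  congr 2
  funext z
  rw [neg_sq, ← neg_sq (z - κ)]
  congr 2
  ring

lemma fErrHat_nonneg (κ f : ℝ) : 0 ≤ fErrHat κ f := by
  refine mul_nonneg (by positivity) (intervalIntegral.integral_nonneg ?_ fun g _ => by positivity)
  linarith [Real.sqrt_nonneg (nuHat κ f)]

/-- The truncation at the level `ν̂`, which a normal variable exceeds with probability `f`, has mean
`f̂_err + f ν̂`. -/
lemma integral_truncatedViolation_nuHat (hf0 : 0 < f) (hf1 : f < 1)
    (hκ : 0 ≤ √2 * erfinv (1 - 2 * f) + κ) :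
    ∫ g, truncatedViolation κ (nuHat κ f) g ∂gaussianReal 0 1 =
      fErrHat κ f + f * nuHat κ f := by
  set ρ := √(nuHat κ f)
  have hρ0 : 0 ≤ ρ := Real.sqrt_nonneg _
  have hρ : nuHat κ f = ρ ^ 2 := (Real.sq_sqrt (sq_nonneg _)).symm
  have hsplit : ∀ g, truncatedViolation κ (nuHat κ f) g =
      (Set.Ioc (κ - ρ) κ).indicator (fun g => (g - κ) ^ 2) g +
        (Set.Iic (κ - ρ)).indicator (fun _ => ρ ^ 2) g := by
    intro g
    rw [truncatedViolation, hρ]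
    rcases le_or_gt g (κ - ρ) with h | h
    · rw [Set.indicator_of_notMem (fun hg => not_lt.2 h hg.1),
        Set.indicator_of_mem (Set.mem_Iic.2 h), zero_add, max_eq_left (by linarith), min_eq_right]
      exact pow_le_pow_left₀ hρ0 (by linarith) 2
    · rw [Set.indicator_of_notMem (s := Set.Iic (κ - ρ)) (fun hg => not_lt.2 hg h), add_zero]
      rcases le_or_gt g κ with h' | h'
      · rw [Set.indicator_of_mem (show g ∈ Set.Ioc (κ - ρ) κ from ⟨h, h'⟩),
          max_eq_left (by linarith), min_eq_left]
        · ring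
        · exact pow_le_pow_left₀ (by linarith) (by linarith) 2
      · rw [Set.indicator_of_notMem (fun hg => not_lt.2 hg.2 h'), max_eq_right (by linarith)]
        simp [sq_nonneg]
  have hi1 : Integrable ((Set.Ioc (κ - ρ) κ).indicator fun g : ℝ => (g - κ) ^ 2)
      (gaussianReal 0 1) := by
    refine Integrable.mono' (integrable_const (ρ ^ 2))
      ((by fun_prop : Measurable fun g : ℝ => (g - κ) ^ 2).indicator
        measurableSet_Ioc).aestronglyMeasurable (ae_of_all _ fun g => ?_)
    by_cases hg : g ∈ Set.Ioc (κ - ρ) κ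
    · rw [Set.indicator_of_mem hg, Real.norm_eq_abs, abs_of_nonneg (sq_nonneg _), ← neg_sq]
      exact pow_le_pow_left₀ (by linarith [hg.2]) (by linarith [hg.1]) 2
    · rw [Set.indicator_of_notMem hg]; simp [sq_nonneg]
  simp_rw [hsplit]
  rw [integral_add hi1 ((integrable_const _).indicator measurableSet_Iic),
    integral_indicator_const _ measurableSet_Iic, ← normalCDF_eq_measureReal,
    normalCDF_sub_sqrt_nuHat hf0 hf1 hκ, hρ, smul_eq_mul]
  congr 1
  rw [← gardnerDerrida_integral_eq, integral_gaussianReal_eq_integral_smul one_ne_zero,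
    intervalIntegral.integral_of_le (by linarith), ← integral_const_mul,
    ← integral_indicator measurableSet_Ioc]
  congr 1
  funext g
  by_cases hg : g ∈ Set.Ioc (κ - ρ) κ
  · rw [Set.indicator_of_mem hg, Set.indicator_of_mem hg]
    simp [gaussianPDFReal]
    ring
  · rw [Set.indicator_of_notMem hg, Set.indicator_of_notMem hg, smul_zero]

/-! ### From the min-max and the perceptron to the residual -/

section MinMax

variable {m n k : ℕ} {κ : ℝ}

lemma objective_eq_sum (H : Matrix (Fin m) (Fin n) ℝ) (x : EuclideanSpace ℝ (Fin n))
    (d : Fin m → ℝ) (l : EuclideanSpace ℝ (Fin m)) :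
    objective κ H x d l = ∑ i, l i * (d i * (κ - H.mulVec x.ofLp i)) := by
  simp only [objective, dotProduct, Matrix.mulVec_diagonal, Finset.mul_sum,
    ← Finset.sum_sub_distrib]
  refine Finset.sum_congr rfl fun i _ => ?_
  simp
  ring

lemma bddAbove_objective (H : Matrix (Fin m) (Fin n) ℝ) (x : EuclideanSpace ℝ (Fin n))
    (d : Fin m → ℝ) :
    BddAbove (Set.range fun l : nonnegUnitVectors m => objective κ H x d l) := by
  refine ⟨∑ i, |d i * (κ - H.mulVec x.ofLp i)|, ?_⟩
  rintro _ ⟨⟨l, hl, -⟩, rfl⟩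
  dsimp only
  rw [objective_eq_sum]
  refine Finset.sum_le_sum fun i _ => (le_abs_self _).trans ?_
  rw [abs_mul]
  refine mul_le_of_le_one_left (abs_nonneg _) ?_
  rw [← hl, ← Real.norm_eq_abs]
  exact PiLp.norm_apply_le l i

/-- When at least one row is left out, the maximum over `λ` is at least the residual: it is attained
at the normalized violation, or at the coordinate vector of a row left out if nothing is violated. -/
lemma residual_le_iSup_objective (hk : k < m) (H : Matrix (Fin m) (Fin n) ℝ)
    (x : EuclideanSpace ℝ (Fin n)) {d : Fin m → ℝ} (hd : d ∈ selectionVectors m k) :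
    residual κ 0 d (H.mulVec x.ofLp) ≤ ⨆ l : nonnegUnitVectors m, objective κ H x d l := by
  set y := H.mulVec x.ofLp
  set R := residual κ 0 d y with hRdef
  have hR0 : 0 ≤ R := Real.sqrt_nonneg _
  have hR2 : R ^ 2 = ∑ i, d i * max (κ - y i) 0 ^ 2 := by
    rw [hRdef, residual, Real.sq_sqrt, zero_pow two_ne_zero, zero_add]
    simpa using sum_violation_nonneg (κ := κ) (nonneg_of_mem_selectionVectors hd) y
  suffices h : ∃ l : nonnegUnitVectors m, R ≤ objective κ H x d l by
    obtain ⟨l, hl⟩ := h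
    exact hl.trans (le_ciSup (bddAbove_objective H x d) l)
  rcases hR0.eq_or_lt with h0 | hpos
  · obtain ⟨i, hi⟩ : ∃ i, d i = 0 := by
      by_contra! hne
      have h1 : ∀ i, d i = 1 := fun i => (hd.1 i).resolve_left (hne i)
      have h2 := hd.2
      simp [h1] at h2
      omega
    refine ⟨⟨EuclideanSpace.single i 1, by simp, fun j => ?_⟩, ?_⟩
    · by_cases hj : j = i <;> simp [hj]
    · rw [objective_eq_sum, ← h0]
      refine le_of_eq (Finset.sum_eq_zero fun j _ => ?_).symm
      by_cases hj : j = i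
      · simp [hj, hi]
      · simp [hj]
  · have hd2 : ∀ i, (d i * max (κ - y i) 0) ^ 2 = d i * max (κ - y i) 0 ^ 2 := fun i => by
      rcases hd.1 i with h | h <;> simp [h]
    refine ⟨⟨WithLp.toLp 2 fun i => d i * max (κ - y i) 0 / R, ?_, fun i => ?_⟩, ?_⟩
    · rw [EuclideanSpace.norm_eq, Real.sqrt_eq_one]
      simp only [Real.norm_eq_abs, sq_abs, div_pow, hd2]
      rw [← Finset.sum_div, ← hR2, div_self (by positivity)]
    · exact div_nonneg (mul_nonneg (nonneg_of_mem_selectionVectors hd i) (le_max_right _ _)) hR0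
    · rw [objective_eq_sum]
      have h : ∀ i, d i * max (κ - y i) 0 / R * (d i * (κ - y i)) =
          d i * max (κ - y i) 0 ^ 2 / R := by
        intro i
        rcases le_total (κ - y i) 0 with h | h
        · simp [max_eq_right h]
        · rw [max_eq_left h]
          rcases hd.1 i with h' | h' <;> simp [h']
          ring
      refine le_of_eq ?_
      change R = ∑ i, d i * max (κ - y i) 0 / R * (d i * (κ - y i))
      simp only [h]
      rw [← Finset.sum_div, ← hR2, sq, mul_self_div_self]

lemma nonempty_selectionVectors (hk : k ≤ m) : (selectionVectors m k).Nonempty := by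
  refine ⟨fun i => if (i : ℕ) < k then 1 else 0, fun i => ?_, ?_⟩
  · by_cases h : (i : ℕ) < k <;> simp [h]
  · rw [Finset.sum_boole, Fin.card_filter_val_lt, min_eq_right hk]

lemma nearlyFeasible_of_xiWb_lt (hn : 0 < n) (hk : k < m) {H : Matrix (Fin m) (Fin n) ℝ} {t : ℝ}
    (h : xiWb κ k H < t) : NearlyFeasible κ k t H := by
  have : Nonempty (Metric.sphere (0 : EuclideanSpace ℝ (Fin n)) 1) :=
    ⟨⟨EuclideanSpace.single ⟨0, hn⟩ 1, by simp⟩⟩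
  have : Nonempty (selectionVectors m k) := (nonempty_selectionVectors hk.le).to_subtype
  obtain ⟨⟨x, d⟩, hp⟩ := exists_lt_of_ciInf_lt h
  exact ⟨x, by simp, d, d.2, (residual_le_iSup_objective hk H x d.2).trans_lt hp⟩

lemma Feasible.nearlyFeasible {H : Matrix (Fin m) (Fin n) ℝ} (h : Feasible κ k H) {t : ℝ}
    (ht : 0 < t) : NearlyFeasible κ k t H := by
  obtain ⟨x, hx, d, hd, hdx⟩ := h
  refine ⟨x, hx, d, hd, ?_⟩
  have h0 : residual κ 0 d (H.mulVec x.ofLp) = 0 := by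
    rw [residual, Finset.sum_eq_zero, zero_pow two_ne_zero, add_zero, Real.sqrt_zero]
    intro i _
    rcases hd.1 i with h | h
    · simp [h]
    · have := hdx i
      rw [h, one_mul] at this
      rw [max_eq_right (by linarith)]
      simp
  rwa [h0]

end MinMax

/-! ### The capacity -/

instance (m n : ℕ) : IsProbabilityMeasure (gaussianMatrix m n) := by
  unfold gaussianMatrix; infer_instance

lemma one_sub_le_measureReal_of_compl_subset {m n : ℕ} {s t : Set (Fin m → Fin n → ℝ)}
    (h : sᶜ ⊆ t) : 1 - (gaussianMatrix m n).real t ≤ (gaussianMatrix m n).real s := by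
  have h1 := measureReal_union_le (μ := gaussianMatrix m n) s sᶜ
  rw [Set.union_compl_self, probReal_univ] at h1
  linarith [measureReal_mono (μ := gaussianMatrix m n) h]

/-- Above the threshold `1 / f̂_err` the perceptron is feasible only with exponentially small
probability. -/
lemma exists_eventually_measureReal_feasible_le {κ f α : ℝ} (hf0 : 0 < f) (hf1 : f < 1)
    (hκ : 0 ≤ √2 * erfinv (1 - 2 * f) + κ) (hα : 0 < α) {m k : ℕ → ℕ}
    (hm : Tendsto (fun n : ℕ => (m n : ℝ) / n) atTop (𝓝 α))
    (hk : Tendsto (fun n : ℕ => (k n : ℝ) / m n) atTop (𝓝 (1 - f)))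
    (hthr : (ENNReal.ofReal (fErrHat κ f))⁻¹ < ENNReal.ofReal α) :
    ∃ c : ℝ, 0 < c ∧ ∀ᶠ n : ℕ in atTop,
      (gaussianMatrix (m n) n).real {H | Feasible κ (k n) (Matrix.of H)} ≤
        Real.exp (-c * n) := by
  have hF : 0 < fErrHat κ f := by
    refine (fErrHat_nonneg κ f).lt_of_ne fun h => ?_
    rw [← h, ENNReal.ofReal_zero, ENNReal.inv_zero] at hthr
    exact not_top_lt hthr
  rw [← ENNReal.ofReal_inv_of_pos hF, ENNReal.ofReal_lt_ofReal_iff hα,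
    inv_lt_iff_one_lt_mul₀ hF, mul_comm] at hthr
  have h1 : 1 < √(α * fErrHat κ f) := by
    rw [Real.lt_sqrt zero_le_one, one_pow, mul_comm]
    linarith
  have hC0 : 0 < (√(α * fErrHat κ f) - 1) / 2 := by linarith
  obtain ⟨c, hc, hev⟩ := exists_eventually_measureReal_nearlyFeasible_le (sq_nonneg _) hα
    (integral_truncatedViolation_nuHat hf0 hf1 hκ) hm hk
    (C := (√(α * fErrHat κ f) - 1) / 2) (by linarith)
  refine ⟨c, hc, ?_⟩
  filter_upwards [hev, eventually_gt_atTop 0] with n hn hn0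
  have hn1 : (0 : ℝ) < √n := Real.sqrt_pos.2 (Nat.cast_pos.2 hn0)
  exact (measureReal_mono fun H hH => Feasible.nearlyFeasible hH (by positivity)).trans hn

lemma tendsto_exp_neg_mul_natCast {c : ℝ} (hc : 0 < c) :
    Tendsto (fun n : ℕ => Real.exp (-c * n)) atTop (𝓝 0) :=
  Real.tendsto_exp_atBot.comp
    (tendsto_natCast_atTop_atTop.const_mul_atTop_of_neg (neg_lt_zero.2 hc))

lemma storageCapacity_le {κ f : ℝ} (hf0 : 0 < f) (hf1 : f < 1)
    (hκ : 0 ≤ √2 * erfinv (1 - 2 * f) + κ) :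
    storageCapacity κ f ≤ (ENNReal.ofReal (fErrHat κ f))⁻¹ := by
  refine iSup₂_le fun α hα => ?_
  obtain ⟨hα, c, hc, hfeas⟩ := hα
  by_contra! hthr
  have hm : Tendsto (fun n : ℕ => (⌊α * n⌋₊ : ℝ) / n) atTop (𝓝 α) :=
    (tendsto_nat_floor_mul_div_atTop hα.le).comp tendsto_natCast_atTop_atTop
  have hm' : Tendsto (fun n : ℕ => (⌊α * n⌋₊ : ℝ)) atTop atTop :=
    tendsto_natCast_atTop_atTop.comp (tendsto_nat_floor_atTop.comp
      (tendsto_natCast_atTop_atTop.const_mul_atTop hα))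
  have hk : Tendsto (fun n : ℕ => (⌈(1 - f) * (⌊α * n⌋₊ : ℝ)⌉₊ : ℝ) / ⌊α * n⌋₊) atTop
      (𝓝 (1 - f)) :=
    (tendsto_nat_ceil_mul_div_atTop (by linarith : 0 ≤ 1 - f)).comp hm'
  obtain ⟨c', hc', hinf⟩ := exists_eventually_measureReal_feasible_le hf0 hf1 hκ hα hm hk hthr
  have hlim := (tendsto_exp_neg_mul_natCast hc).add (tendsto_exp_neg_mul_natCast hc')
  rw [add_zero] at hlim
  obtain ⟨n, h1, h2, h3⟩ := (hfeas.and (hinf.and (hlim.eventually_lt_const one_pos))).exists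
  linarith

end SphericalPerceptron

open SphericalPerceptron
theorem mainTheorem1
    (κ f : ℝ) (hf0 : 0 < f) (hf1 : f < 1)
    (hκ : 0 ≤ √2 * erfinv (1 - 2 * f) + κ)
    (α : ℝ) (hα : 0 < α) (m k : ℕ → ℕ)
    (hm : Tendsto (fun n : ℕ => (m n : ℝ) / n) atTop (𝓝 α))
    (hk : Tendsto (fun n : ℕ => (k n : ℝ) / m n) atTop (𝓝 (1 - f))) :
    -- the lower bound on the min-max
    (∀ ε₁ ε₂ ε₃ : ℝ, 0 < ε₁ → 0 < ε₂ → 0 < ε₃ → ∀ ξ : ℕ → ℝ,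
      (∀ᶠ n : ℕ in atTop,
        ξ n / √n < (1 - ε₁) * √(α * fErrHat κ f) - (1 + ε₂) - ε₃) →
      Tendsto (fun n => (gaussianMatrix (m n) n).real {H | ξ n ≤ xiWb κ (k n) (Matrix.of H)})
        atTop (𝓝 1)) ∧
    -- infeasibility with overwhelming probability
    ((ENNReal.ofReal (fErrHat κ f))⁻¹ < ENNReal.ofReal α →
      WithOverwhelmingProbability m fun n H => ¬ Feasible κ (k n) H) ∧
    -- the replica prediction is well defined, equals the threshold, and bounds the capacity
    (∃! x : ℝ, GardnerDerridaEquation κ f x) ∧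
    (∀ x : ℝ, GardnerDerridaEquation κ f x →
      x = √(nuHat κ f) ∧
      gardnerDerridaCapacity κ x = (ENNReal.ofReal (fErrHat κ f))⁻¹ ∧
      storageCapacity κ f ≤ gardnerDerridaCapacity κ x) := by
  have hGD := gardnerDerridaEquation_iff hf0 hf1 hκ
  have hcap : gardnerDerridaCapacity κ (√(nuHat κ f)) = (ENNReal.ofReal (fErrHat κ f))⁻¹ := by
    rw [gardnerDerridaCapacity, gardnerDerrida_integral_eq]
  refine ⟨fun ε₁ ε₂ ε₃ h₁ h₂ h₃ ξ hξ => ?_, fun hthr => ?_, ?_, fun x hx => ?_⟩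
  · set C := (1 - ε₁) * √(α * fErrHat κ f) - (1 + ε₂) - ε₃
    have hC : C < √(α * fErrHat κ f) - 1 := by
      have := mul_nonneg h₁.le (Real.sqrt_nonneg (α * fErrHat κ f))
      simp only [C]
      linarith
    obtain ⟨c, hc, hev⟩ := exists_eventually_measureReal_nearlyFeasible_le (sq_nonneg _) hα
      (integral_truncatedViolation_nuHat hf0 hf1 hκ) hm hk hC
    have hlim : Tendsto (fun n : ℕ => 1 - Real.exp (-c * n)) atTop (𝓝 1) := by
      simpa using (tendsto_exp_neg_mul_natCast hc).const_sub 1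
    refine tendsto_of_tendsto_of_tendsto_of_le_of_le' hlim tendsto_const_nhds ?_
      (Eventually.of_forall fun n => measureReal_le_one)
    filter_upwards [hev, hξ, eventually_gt_atTop 0, hm.eventually_const_lt hα,
      hk.eventually_lt_const (by linarith : 1 - f < 1)] with n hn hξn hn0 hmn hkn
    have hn1 : (0 : ℝ) < n := Nat.cast_pos.2 hn0
    have hm0 : (0 : ℝ) < m n := (div_pos_iff_of_pos_right hn1).1 hmn
    rw [div_lt_one hm0, Nat.cast_lt] at hkn
    rw [div_lt_iff₀ (Real.sqrt_pos.2 hn1)] at hξn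
    refine le_trans (by linarith) (one_sub_le_measureReal_of_compl_subset
      (t := {H | NearlyFeasible κ (k n) (C * √n) (Matrix.of H)}) fun H hH => ?_)
    have hlt : xiWb κ (k n) (Matrix.of H) < ξ n := not_le.1 hH
    exact nearlyFeasible_of_xiWb_lt hn0 hkn (hlt.trans hξn)
  · obtain ⟨c, hc, hev⟩ := exists_eventually_measureReal_feasible_le hf0 hf1 hκ hα hm hk hthr
    refine ⟨c, hc, ?_⟩
    filter_upwards [hev] with n hn
    refine le_trans (by linarith) (one_sub_le_measureReal_of_compl_subset
      (t := {H | Feasible κ (k n) (Matrix.of H)}) fun H hH => ?_)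
    exact not_not.1 hH
  · exact ⟨√(nuHat κ f), (hGD _).2 rfl, fun x hx => (hGD x).1 hx⟩
  · obtain rfl := (hGD x).1 hx
    exact ⟨rfl, hcap, hcap ▸ storageCapacity_le hf0 hf1 hκ⟩
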